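/- **Theorem 4.1.** Let $d\ge 2$. Let $\Omega\subseteq\mathbb R^d$ be open, $\Phi\in C^1(\Omega)$, and let $S=\{x\in\Omega:\Phi(x)=0\}$ be bounded with $\nabla\Phi\neq0$ on $S$; write $|S|$ for its $(d-1)$-dimensional area. Let $\mathbb M$ be a symmetric-matrix-valued $C^1$ function on an open set $U$ containing the convex hull $\operatorname{conv}S$, with $\underline m I\le\mathbb M(x)\le\overline m I$ for $x\in\operatorname{conv}S$, where $\underline m,\overline m>0$ are constants. A mesh has $N_v$ vertices and $N$ elements with fixed connectivity; each element $K$ is the $(d-1)$-dimensional simplex in $\mathbb R^d$ spanned by $d$ of the vertices $x_1,\dots,x_{N_v}$, $|K|$ is its $(d-1)$-dimensional area, $x_K$ its barycentre, and $\mathbb M_K=\frac1{|K|}\int_K\mathbb M\,dx$. Let $\hat K\subset\mathbb R^{d-1}$ be an equilateral $(d-1)$-simplex with $|\hat K|=1/N$, let $F_K'=E_K\hat E^{-1}$ be the Jacobian matrix of the affine map from $\hat K$ to $K$ ($E_K$, $\hat E$ are the edge matrices), and put $\mathbb J_K=((F_K')^T\mathbb M_KF_K')^{-1}$, $r_K=\det((F_K')^T\mathbb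 M_KF_K')^{-1}$. The meshing function is $$I_h(x_1,\dots,x_{N_v})=\sum_K|\hat K|\det\big((F_K')^T\mathbb M_KF_K'\big)^{1/2}\,\tilde G(\mathbb J_K,r_K,x_K),$$ where $\tilde G(\mathbb J,r,x)$ is $C^1$ for $\mathbb J$ symmetric positive definite, $r>0$, $x\in U$, and satisfies the coercivity condition $$\tilde G(\mathbb J,\det\mathbb J,x)\ \ge\ \alpha\,(\operatorname{tr}\mathbb J)^q-\beta\qquad\text{for all symmetric positive definite }\mathbb J\text{ and }x\in\operatorname{conv}S,$$ with constants $\alpha>0$, $\beta\ge0$, $q>(d-1)/2$. Let $\mathcal T_h(t)=(x_1(t),\dots,x_{N_v}(t))$ be a trajectory of the surface moving mesh equation on a time interval with first time $0$ (such as $[0,\infty)$): it is continuous, the vertices stay in $\Omega$ and lie on $S$ at $t=0$, and at all times at which every element has positive area $$\frac{dx_i}{dt}=-\frac{P_i}{\tau}\Big[\frac{\partial I_h}{\partial x_i}-\Big(\frac{\partial I_h}{\partial x_i}\cdot n_i\Big)n_i\Big],\qquad n_i=\frac{\nabla\Phi(x_i)}{\|\nabla\Phi(x_i)\|},\quad i=1,\dots,N_v,$$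 where $\tau>0$ is a constant and each $P_i$ is a function of the mesh, positive when the vertices lie on $S$. Suppose that all elements have positive area at $t=0$. Then all elements have positive area at all times $t$ of the interval. Moreover, let $e=\frac{d-1}2$, or let $e=\frac d2$ if $\overline m\ge1$. Then, at every time $t$ of the interval at which the total area of the elements does not exceed $|S|$ (and at every time $t$ if $\beta=0$), each element $K$ satisfies $$a_{K,\mathbb M_K}\ge C_1\big[I_h(\mathcal T_h(0))+\beta\,\overline m^{\,e}|S|\big]^{-\frac1{2q-d+1}}N^{-\frac{2q}{(d-1)(2q-d+1)}},$$ $$|K|\ge C_2\big[I_h(\mathcal T_h(0))+\beta\,\overline m^{\,e}|S|\big]^{-\frac{d-1}{2q-d+1}}N^{-\frac{2q}{2q-d+1}}\,\overline m^{\,-e},$$ where $a_{K,\mathbb M_K}$ is the minimum altitude of $K$ in the metric $\|w\|_{\mathbb M_K}=\sqrt{w^T\mathbb M_Kw}$, and $$C_1=\left(\frac{\alpha\,d^{\frac{q(d-2)}{d-1}}\,(d-1)!^{\frac{2q-d+1}{d-1}}}{(d-1)^{\frac{d-1+2q}2}}\right)^{\frac1{2q-d+1}},\qquad C_2=\frac{C_1^{d-1}}{(d-1)^{\frac{d-1}2}(d-1)!}.$$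 -/

import Mathlib

open scoped MeasureTheory Matrix Gradient

noncomputable section

namespace SurfaceMesh

/-- Euclidean space `ℝ^k`. The ambient space is `Pt (n + 1)`, so that the dimension called `d`
is `n + 1`; surface elements are `n`-dimensional simplices with vertices `v 0, …, v n`. -/
abbrev Pt (k : ℕ) : Type := EuclideanSpace ℝ (Fin k)

/-- The (closed) simplex with the given vertices. -/
def simplex {k m : ℕ} (v : Fin m → Pt k) : Set (Pt k) := convexHull ℝ (Set.range v)

/-- The `n`-dimensional area of a subset of `ℝ^k`: Hausdorff measure, normalised to agree with
Lebesgue measure on `ℝ^n`. -/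
def area (n : ℕ) {k : ℕ} (A : Set (Pt k)) : ℝ := (μHE[n] A).toReal

/-- All edges of the simplex have the same length. -/
def IsEquilateral {k m : ℕ} (v : Fin m → Pt k) : Prop :=
  ∃ s : ℝ, ∀ i j, i ≠ j → dist (v i) (v j) = s

/-- The edge matrix, with columns `v 1 - v 0, …, v n - v 0`. -/
def edgeMatrix {n k : ℕ} (v : Fin (n + 1) → Pt k) : Matrix (Fin k) (Fin n) ℝ :=
  Matrix.of fun i j => v j.succ i - v 0 i

/-- The Jacobian matrix `F_K' = E_K Ê⁻¹` of the affine map that takes the simplex with vertices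
`ξ 0, …, ξ n` to the one with vertices `v 0, …, v n`. -/
def jacobian {n : ℕ} (ξ : Fin (n + 1) → Pt n) (v : Fin (n + 1) → Pt (n + 1)) :
    Matrix (Fin (n + 1)) (Fin n) ℝ :=
  edgeMatrix v * (edgeMatrix ξ)⁻¹

/-- The average `M_K` of the metric tensor over the element with vertices `v`, with respect to
the `n`-dimensional area. -/
def avgMetric {n : ℕ} (M : Pt (n + 1) → Matrix (Fin (n + 1)) (Fin (n + 1)) ℝ)
    (v : Fin (n + 1) → Pt (n + 1)) : Matrix (Fin (n + 1)) (Fin (n + 1)) ℝ :=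
  Matrix.of fun i j =>
    (area n (simplex v))⁻¹ * ∫ x in simplex v, M x i j ∂(μHE[n] : MeasureTheory.Measure (Pt (n + 1)))

/-- The matrix `(F_K')ᵀ M_K F_K'`. -/
def pullback {n : ℕ} (ξ : Fin (n + 1) → Pt n)
    (M : Pt (n + 1) → Matrix (Fin (n + 1)) (Fin (n + 1)) ℝ)
    (v : Fin (n + 1) → Pt (n + 1)) : Matrix (Fin n) (Fin n) ℝ :=
  (jacobian ξ v)ᵀ * avgMetric M v * jacobian ξ v

/-- The barycentre of an element. -/
def barycentre {n : ℕ} (v : Fin (n + 1) → Pt (n + 1)) : Pt (n + 1) :=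
  ((n : ℝ) + 1)⁻¹ • ∑ j, v j

/-- The length of a vector in the metric given by the matrix `A`. -/
def metricNorm {k : ℕ} (A : Matrix (Fin k) (Fin k) ℝ) (w : Pt k) : ℝ :=
  Real.sqrt (w.ofLp ⬝ᵥ A *ᵥ w.ofLp)

/-- The minimum altitude of a simplex in the metric given by `A`: the smallest of the distances,
measured in that metric, of a vertex from the affine hull of the other vertices. -/
def minAltitude {n k : ℕ} (A : Matrix (Fin k) (Fin k) ℝ) (v : Fin (n + 1) → Pt k) : ℝ :=
  ⨅ j : Fin (n + 1), ⨅ y : affineSpan ℝ (v '' {j}ᶜ), metricNorm A (v j - y)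

section Mesh

/- A mesh has vertices indexed by `ν`, elements indexed by `κ`, and a connectivity `conn`, which
lists the (global indices of the) vertices of each element. Its configuration is `x : ν → ℝ^d`. -/
variable {n : ℕ} {ν κ : Type*} [Fintype κ]

/-- The vertices of the element `K`. -/
def elem (conn : κ → Fin (n + 1) → ν) (x : ν → Pt (n + 1)) (K : κ) : Fin (n + 1) → Pt (n + 1) :=
  fun j => x (conn K j)

/-- The Euclidean area `|K|` of the element `K`. -/
def elemArea (conn : κ → Fin (n + 1) → ν) (x : ν → Pt (n + 1)) (K : κ) : ℝ :=
  area n (simplex (elem conn x K))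

/-- The meshing function
`I_h(x) = ∑_K |K̂| det((F_K')ᵀ M_K F_K')^{1/2} G̃(J_K, r_K, x_K)` with
`J_K = ((F_K')ᵀ M_K F_K')⁻¹`, `r_K = det((F_K')ᵀ M_K F_K')⁻¹` and `x_K` the barycentre of `K`. -/
def meshEnergy (ξ : Fin (n + 1) → Pt n)
    (M : Pt (n + 1) → Matrix (Fin (n + 1)) (Fin (n + 1)) ℝ)
    (G : Matrix (Fin n) (Fin n) ℝ → ℝ → Pt (n + 1) → ℝ)
    (conn : κ → Fin (n + 1) → ν) (x : ν → Pt (n + 1)) : ℝ :=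
  ∑ K, area n (simplex ξ) * Real.sqrt (pullback ξ M (elem conn x K)).det *
    G (pullback ξ M (elem conn x K))⁻¹ (pullback ξ M (elem conn x K)).det⁻¹
      (barycentre (elem conn x K))

/-- The partial gradient `∂I/∂x_i` of a function of the mesh with respect to the `i`-th vertex. -/
def vertexGradient [DecidableEq ν] (I : (ν → Pt (n + 1)) → ℝ) (x : ν → Pt (n + 1)) (i : ν) :
    Pt (n + 1) :=
  ∇ (fun y => I (Function.update x i y)) (x i)

/-- The unit normal `∇Φ / ‖∇Φ‖` of the level set of `Φ` through `y`. -/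
def unitNormal (Φ : Pt (n + 1) → ℝ) (y : Pt (n + 1)) : Pt (n + 1) := ‖∇ Φ y‖⁻¹ • ∇ Φ y

/-- The right-hand side of the surface moving mesh equation: minus `P_i / τ` times the projection
of `∂I/∂x_i` to the tangent plane of the surface `Φ = 0` at `x_i`. -/
def mmpdeVelocity [DecidableEq ν] (Φ : Pt (n + 1) → ℝ) (P : ν → (ν → Pt (n + 1)) → ℝ) (τ : ℝ)
    (I : (ν → Pt (n + 1)) → ℝ) (x : ν → Pt (n + 1)) (i : ν) : Pt (n + 1) :=
  -(P i x / τ) • (vertexGradient I x i -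
    (inner ℝ (vertexGradient I x i) (unitNormal Φ (x i))) • unitNormal Φ (x i))

/-- `X` is a trajectory, over the time interval `T` with first time `0` (for example `[0, ∞)` or
`[0, t₁)`), of the surface moving mesh equation for the surface `{y ∈ Ω | Φ y = 0}`: it is
continuous, its vertices start on the surface and stay in the region `Ω` in which the
surface is described by `Φ`, and it satisfies the differential equation at every time at which no
element is degenerate (the right-hand side makes no sense at other times). -/
structure IsTrajectory [DecidableEq ν] (Ω : Set (Pt (n + 1))) (Φ : Pt (n + 1) → ℝ)
    (conn : κ → Fin (n + 1) → ν) (P : ν → (ν → Pt (n + 1)) → ℝ) (τ : ℝ)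
    (I : (ν → Pt (n + 1)) → ℝ) (T : Set ℝ) (X : ℝ → ν → Pt (n + 1)) : Prop where
  zero_mem : 0 ∈ T
  nonneg : T ⊆ Set.Ici 0
  interval : T.OrdConnected
  continuousOn : ContinuousOn X T
  initial : ∀ i, X 0 i ∈ Ω ∧ Φ (X 0 i) = 0
  mem : ∀ t ∈ T, ∀ i, X t i ∈ Ω
  equation : ∀ t ∈ T, (∀ K, 0 < elemArea conn (X t) K) →
    ∀ i, HasDerivWithinAt (fun s => X s i) (mmpdeVelocity Φ P τ I (X t) i) T t

end Mesh

/-- The constant `C₁`. -/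
def C1 (d : ℕ) (α q : ℝ) : ℝ :=
  (α * (d : ℝ) ^ (q * ((d : ℝ) - 2) / ((d : ℝ) - 1)) *
      (Nat.factorial (d - 1) : ℝ) ^ ((2 * q - d + 1) / ((d : ℝ) - 1)) /
    ((d : ℝ) - 1) ^ (((d : ℝ) - 1 + 2 * q) / 2)) ^ (1 / (2 * q - d + 1))

/-- The constant `C₂`. -/
def C2 (d : ℕ) (α q : ℝ) : ℝ :=
  C1 d α q ^ (d - 1) / (((d : ℝ) - 1) ^ (((d : ℝ) - 1) / 2) * (Nat.factorial (d - 1) : ℝ))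

end SurfaceMesh

end

open SurfaceMesh

/-! Write n = d - 1, H = Eᵀ M_K E for the edge matrix E of an element K, and Q_j for the value of
H⁻¹ on the linear part of the j-th barycentric coordinate; 1/Q_j is the squared altitude of vertex j
in the metric M_K. Because the reference element is equilateral, tr J_K is a fixed multiple of ∑ Q_j
(`trace_pullback_inv`), and the weight of K in the energy is its area in the metric
(`area_mul_sqrt_det_pullback`). Coercivity therefore penalises small altitudes. By the inequality of
the means the weight is at least a constant times (tr J_K)^(-n/2); since q > n/2, weight times (tr
J_K)^q still grows with tr J_K. An energy bound thus bounds every Q_j from above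
(`altitudeBound_sq_mul_coordForm_le`), hence the altitudes from below, and the means inequality for
H⁻¹ turns this into a lower bound for the area (`element_bounds`).

For the flow, the velocity is a negative multiple of the tangential part of the gradient. As long as
no element degenerates, the vertices stay on S (`IsTrajectory.mem_surface`) and the energy does not
increase (`IsTrajectory.energy_le`). As S is bounded, so is the total area of meshes on S; this
gives a positive lower bound for the areas that does not depend on time. By continuity it persists
at a first time of degeneration, which therefore cannot exist (`IsTrajectory.elemArea_pos`). The
chain rule for the energy needs M_K to be differentiable in the vertices: it is an integral over a
fixed domain (`avgMetric_apply`), differentiated under the integral sign. -/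

namespace SurfaceMesh

/-! ### Volume and compactness of the corner simplex. -/

section Volume
open MeasureTheory

/-- The corner simplex `{y ≥ 0, ∑ y ≤ c}` in `ℝ^n` has volume `c ^ n / n!`. -/
theorem volume_corner_pi (n : ℕ) : ∀ c : ℝ, 0 ≤ c →
    volume {y : Fin n → ℝ | (∀ i, 0 ≤ y i) ∧ ∑ i, y i ≤ c} =
      ENNReal.ofReal (c ^ n / n.factorial) := by
  induction n with
  | zero =>
    intro c hc
    simp [hc, volume_pi]
  | succ n ih =>
    intro c hc
    have hclosed : IsClosed {p : ℝ × (Fin n → ℝ) | 0 ≤ p.1 ∧ (∀ i, 0 ≤ p.2 i) ∧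
        p.1 + ∑ i, p.2 i ≤ c} := by
      have h1 : IsClosed {p : ℝ × (Fin n → ℝ) | 0 ≤ p.1} :=
        isClosed_le continuous_const continuous_fst
      have h2 : IsClosed {p : ℝ × (Fin n → ℝ) | ∀ i, 0 ≤ p.2 i} := by
        simp only [Set.ofPred_forall]
        exact isClosed_iInter fun i => isClosed_le continuous_const (by fun_prop)
      have h3 : IsClosed {p : ℝ × (Fin n → ℝ) | p.1 + ∑ i, p.2 i ≤ c} :=
        isClosed_le (by fun_prop) continuous_const
      exact h1.inter (h2.inter h3)
    have hpre : {y : Fin (n + 1) → ℝ | (∀ i, 0 ≤ y i) ∧ ∑ i, y i ≤ c} =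
        (MeasurableEquiv.piFinSuccAbove (fun _ => ℝ) 0) ⁻¹' {p : ℝ × (Fin n → ℝ) |
          0 ≤ p.1 ∧ (∀ i, 0 ≤ p.2 i) ∧ p.1 + ∑ i, p.2 i ≤ c} := by
      ext y
      simp [MeasurableEquiv.piFinSuccAbove_apply, Fin.forall_fin_succ, Fin.sum_univ_succ,
        Fin.tail, Fin.insertNthEquiv, and_assoc]
    rw [hpre, (volume_preserving_piFinSuccAbove (fun _ : Fin (n + 1) => ℝ) 0).measure_preimage
      hclosed.measurableSet.nullMeasurableSet]
    change (volume.prod volume) _ = _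
    rw [Measure.prod_apply hclosed.measurableSet]
    -- The slice at first coordinate t is a corner simplex of size c - t, empty unless 0 ≤ t ≤ c;
    -- this is why the induction runs over all sizes c.
    have hslice : ∀ t : ℝ, volume (Prod.mk t ⁻¹' {p : ℝ × (Fin n → ℝ) | 0 ≤ p.1 ∧
        (∀ i, 0 ≤ p.2 i) ∧ p.1 + ∑ i, p.2 i ≤ c}) =
        (Set.Icc 0 c).indicator (fun t => ENNReal.ofReal ((c - t) ^ n / n.factorial)) t := by
      intro t
      by_cases ht : t ∈ Set.Icc 0 c
      · rw [Set.indicator_of_mem ht, ← ih (c - t) (by linarith [ht.2])]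
        congr 1
        ext z
        simp only [Set.mem_preimage, Set.mem_ofPred_eq, ht.1, true_and, le_sub_iff_add_le']
      · rw [Set.indicator_of_notMem ht]
        convert! measure_empty (μ := volume)
        ext z
        simp only [Set.mem_preimage, Set.mem_ofPred_eq, Set.mem_empty_iff_false, iff_false]
        rintro ⟨h0, hz, hs⟩
        exact ht ⟨h0, by linarith [Finset.sum_nonneg fun i (_ : i ∈ Finset.univ) => hz i]⟩
    simp_rw [hslice]
    rw [lintegral_indicator measurableSet_Icc, ← ofReal_integral_eq_lintegral_ofReal]
    · congr 1
      rw [integral_Icc_eq_integral_Ioc, ← intervalIntegral.integral_of_le hc,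
        intervalIntegral.integral_comp_sub_left (fun t => t ^ n / (n.factorial : ℝ)),
        intervalIntegral.integral_div, integral_pow]
      simp only [sub_self, sub_zero, Nat.factorial_succ]
      push_cast
      field_simp
      simp
    · exact (Continuous.continuousOn (by fun_prop)).integrableOn_Icc
    · filter_upwards [ae_restrict_mem measurableSet_Icc] with t ht
      have : 0 ≤ c - t := by linarith [ht.2]
      positivity

/-- The corner simplex, the convex hull of the origin and the standard basis. -/
def corner (n : ℕ) : Set (Pt n) := {y | (∀ i, 0 ≤ y i) ∧ ∑ i, y i ≤ 1}

theorem volume_corner (n : ℕ) : volume (corner n) = ENNReal.ofReal (1 / n.factorial) := by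
  have h := (EuclideanSpace.volume_preserving_symm_measurableEquiv_toLp (Fin n))
  have := h.measure_preimage_equiv {y : Fin n → ℝ | (∀ i, 0 ≤ y i) ∧ ∑ i, y i ≤ 1}
  rw [volume_corner_pi n 1 zero_le_one, one_pow] at this
  exact this

theorem isClosed_corner (n : ℕ) : IsClosed (corner n) := by
  have h2 : IsClosed {y : Pt n | ∀ i, 0 ≤ y i} := by
    simp only [Set.ofPred_forall]
    exact isClosed_iInter fun i => isClosed_le continuous_const (by fun_prop)
  have h1 : IsClosed {y : Pt n | ∑ i, y i ≤ 1} := isClosed_le (by fun_prop) continuous_const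
  exact h2.inter h1

theorem convex_corner (n : ℕ) : Convex ℝ (corner n) := by
  rintro x ⟨hx, hx1⟩ y ⟨hy, hy1⟩ a b ha hb hab
  refine ⟨fun i => ?_, ?_⟩
  · have := hx i
    have := hy i
    simp only [PiLp.add_apply, PiLp.smul_apply, smul_eq_mul]
    positivity
  · simp only [PiLp.add_apply, PiLp.smul_apply, smul_eq_mul, Finset.sum_add_distrib,
      ← Finset.mul_sum]
    nlinarith

theorem isCompact_corner (n : ℕ) : IsCompact (corner n) := by
  refine Metric.isCompact_of_isClosed_isBounded (isClosed_corner n) ?_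
  refine (Metric.isBounded_closedBall (x := (0 : Pt n)) (r := Real.sqrt n)).subset ?_
  rintro y ⟨hy, hy1⟩
  rw [mem_closedBall_zero_iff, EuclideanSpace.norm_eq]
  refine Real.sqrt_le_sqrt ?_
  calc ∑ i, ‖y i‖ ^ 2 ≤ ∑ i : Fin n, (1 : ℝ) := by
        refine Finset.sum_le_sum fun i _ => ?_
        have h1 : y i ≤ 1 :=
          (Finset.single_le_sum (fun j _ => hy j) (Finset.mem_univ i)).trans hy1
        rw [Real.norm_eq_abs, sq_abs]
        nlinarith [hy i]
    _ = n := by simp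

end Volume

/-! ### Areas and integrals over elements, pulled back to the corner simplex. -/

section EdgeMap

variable {n k : ℕ}

/-- The linear map `y ↦ ∑ y_j (v_{j+1} - v_0)` given by the edge matrix. -/
noncomputable def edgeMap (v : Fin (n + 1) → Pt k) : Pt n →L[ℝ] Pt k :=
  ∑ j : Fin n, (EuclideanSpace.proj j : Pt n →L[ℝ] ℝ).smulRight (v j.succ - v 0)

theorem edgeMap_apply (v : Fin (n + 1) → Pt k) (y : Pt n) :
    edgeMap v y = ∑ j : Fin n, y j • (v j.succ - v 0) := by
  simp [edgeMap]

theorem edgeMap_ofLp (v : Fin (n + 1) → Pt k) (y : Pt n) :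
    (edgeMap v y).ofLp = edgeMatrix v *ᵥ y.ofLp := by
  ext i
  simp [edgeMap_apply, edgeMatrix, Matrix.mulVec, dotProduct, mul_comm]

/-- The parametrisation of a simplex by the corner simplex. -/
noncomputable def param (v : Fin (n + 1) → Pt k) (y : Pt n) : Pt k := v 0 + edgeMap v y

theorem continuous_param (v : Fin (n + 1) → Pt k) : Continuous (param v) := by
  unfold param; fun_prop

/-- The barycentric coordinates of a point of the corner simplex. -/
noncomputable def baryCoord (y : Pt n) : Fin (n + 1) → ℝ := Fin.cons (1 - ∑ i, y i) fun i => y i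

theorem param_eq_sum (v : Fin (n + 1) → Pt k) (y : Pt n) :
    param v y = ∑ j, baryCoord y j • v j := by
  rw [param, edgeMap_apply, Fin.sum_univ_succ]
  simp only [baryCoord, Fin.cons_zero, Fin.cons_succ, smul_sub, Finset.sum_sub_distrib,
    ← Finset.sum_smul, sub_smul, one_smul]
  abel

theorem sum_baryCoord (y : Pt n) : ∑ j, baryCoord y j = 1 := by
  simp [baryCoord, Fin.sum_univ_succ]

theorem baryCoord_nonneg {y : Pt n} (hy : y ∈ corner n) (j : Fin (n + 1)) :
    0 ≤ baryCoord y j := by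
  refine Fin.cases ?_ (fun i => ?_) j
  · simpa [baryCoord] using hy.2
  · simpa [baryCoord] using hy.1 i

/-- The corner simplex consists of barycentric coordinates with the zeroth one dropped. Affine
independence plays no role, so degenerate elements are covered. -/
theorem simplex_eq_image (v : Fin (n + 1) → Pt k) : simplex v = param v '' corner n := by
  apply Set.Subset.antisymm
  · refine convexHull_min ?_ ?_
    · rintro _ ⟨j, rfl⟩
      refine Fin.cases ?_ (fun i => ?_) j
      · exact ⟨0, ⟨by simp, by simp⟩, by simp [param]⟩
      · refine ⟨EuclideanSpace.single i 1, ⟨fun l => ?_, ?_⟩, ?_⟩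
        · by_cases h : l = i <;> simp [h]
        · simp [PiLp.single_apply]
        · simp [param, edgeMap_apply, PiLp.single_apply]
    · have : param v '' corner n = (fun z => v 0 + z) '' (edgeMap v '' corner n) := by
        rw [Set.image_image]; rfl
      rw [this]
      exact ((convex_corner n).is_linear_image (edgeMap v).isLinear).translate (v 0)
  · rintro _ ⟨y, hy, rfl⟩
    rw [param_eq_sum]
    exact (convex_convexHull ℝ _).sum_mem (fun j _ => baryCoord_nonneg hy j) (sum_baryCoord y)
      fun j _ => subset_convexHull ℝ _ ⟨j, rfl⟩

theorem isCompact_simplex (v : Fin (n + 1) → Pt k) : IsCompact (simplex v) := by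
  rw [simplex_eq_image]
  exact (isCompact_corner n).image (continuous_param v)

/-- The factor by which a linear map scales n-dimensional volume is the root of the Gram determinant
of the images of an orthonormal basis, here the edge vectors. -/
theorem normDet_edgeMap_sq (v : Fin (n + 1) → Pt k) :
    (edgeMap v).toLinearMap.normDet ^ 2 = ((edgeMatrix v)ᵀ * edgeMatrix v).det := by
  have h := (edgeMap v).toLinearMap.normDet_sq_eq_det_gram (EuclideanSpace.basisFun (Fin n) ℝ)
  simp only [RCLike.ofReal_real_eq_id, id] at h
  rw [h]
  congr 1
  ext i j
  simp [Matrix.gram, edgeMap_apply, PiLp.single_apply, Matrix.mul_apply, edgeMatrix, PiLp.inner_apply, mul_comm]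

theorem normDet_edgeMap (v : Fin (n + 1) → Pt k) :
    (edgeMap v).toLinearMap.normDet = Real.sqrt ((edgeMatrix v)ᵀ * edgeMatrix v).det := by
  rw [← normDet_edgeMap_sq, Real.sqrt_sq (LinearMap.normDet_nonneg _)]

theorem hausdorff_param_image (v : Fin (n + 1) → Pt k) (s : Set (Pt n)) :
    μHE[n] (param v '' s) =
      ENNReal.ofReal (Real.sqrt ((edgeMatrix v)ᵀ * edgeMatrix v).det) *
        (MeasureTheory.volume : MeasureTheory.Measure (Pt n)) s := by
  have h := (edgeMap v).toLinearMap.euclideanHausdorffMeasure_image_eq_normDet_mul_volume s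
  rw [normDet_edgeMap, finrank_euclideanSpace_fin] at h
  rw [← h]
  have : param v '' s = (fun z => v 0 + z) '' (edgeMap v '' s) := by
    rw [Set.image_image]; rfl
  rw [this, (isometry_add_left (v 0)).euclideanHausdorffMeasure_image]
  rfl

theorem area_simplex (v : Fin (n + 1) → Pt k) :
    area n (simplex v) = Real.sqrt ((edgeMatrix v)ᵀ * edgeMatrix v).det / n.factorial := by
  rw [area, simplex_eq_image, hausdorff_param_image, volume_corner, ENNReal.toReal_mul,
    ENNReal.toReal_ofReal (Real.sqrt_nonneg _), ENNReal.toReal_ofReal (by positivity)]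
  ring

theorem restrict_simplex (v : Fin (n + 1) → Pt k) :
    (μHE[n] : MeasureTheory.Measure (Pt k)).restrict (simplex v) =
      ENNReal.ofReal (Real.sqrt ((edgeMatrix v)ᵀ * edgeMatrix v).det) •
        (MeasureTheory.volume.restrict (corner n)).map (param v) := by
  ext s hs
  rw [MeasureTheory.Measure.restrict_apply hs, MeasureTheory.Measure.smul_apply,
    MeasureTheory.Measure.map_apply (continuous_param v).measurable hs,
    MeasureTheory.Measure.restrict_apply ((continuous_param v).measurable hs), smul_eq_mul,
    ← hausdorff_param_image, simplex_eq_image, Set.image_preimage_inter]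

theorem edgeMap_injective {v : Fin (n + 1) → Pt k}
    (hv : 0 < ((edgeMatrix v)ᵀ * edgeMatrix v).det) : Function.Injective (edgeMap v) := by
  have h : (edgeMap v).toLinearMap.normDet ≠ 0 := by
    rw [normDet_edgeMap]; exact (Real.sqrt_pos.2 hv).ne'
  exact ((edgeMap v).toLinearMap.normDet_ne_zero_tfae.out 0 4).1 h

/-- Nondegeneracy makes `param v` a measurable embedding, so the change of variables needs no
regularity of f. -/
theorem integral_simplex {v : Fin (n + 1) → Pt k}
    (hv : 0 < ((edgeMatrix v)ᵀ * edgeMatrix v).det) (f : Pt k → ℝ) :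
    ∫ x in simplex v, f x ∂(μHE[n] : MeasureTheory.Measure (Pt k)) =
      Real.sqrt ((edgeMatrix v)ᵀ * edgeMatrix v).det *
        ∫ y in corner n, f (param v y) := by
  have hemb : MeasurableEmbedding (param v) :=
    ((Homeomorph.addLeft (v 0)).isClosedEmbedding.comp
      (LinearMap.isClosedEmbedding_of_injective (f := (edgeMap v).toLinearMap)
        (LinearMap.ker_eq_bot.2 (edgeMap_injective hv)))).measurableEmbedding
  rw [restrict_simplex, MeasureTheory.integral_smul_measure, hemb.integral_map,
    ENNReal.toReal_ofReal (Real.sqrt_nonneg _), smul_eq_mul]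

/-- The Jacobian factor cancels against the area. What remains has a domain of integration
independent of v, the form suited to differentiation in the vertices. -/
theorem avgMetric_apply {M : Pt (n + 1) → Matrix (Fin (n + 1)) (Fin (n + 1)) ℝ}
    {v : Fin (n + 1) → Pt (n + 1)} (hv : 0 < ((edgeMatrix v)ᵀ * edgeMatrix v).det)
    (i j : Fin (n + 1)) :
    avgMetric M v i j = n.factorial * ∫ y in corner n, M (param v y) i j := by
  have := Real.sqrt_pos.2 hv
  simp only [avgMetric, Matrix.of_apply, integral_simplex hv, area_simplex]
  field_simp

theorem area_simplex_pos_iff (v : Fin (n + 1) → Pt k) :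
    0 < area n (simplex v) ↔ 0 < ((edgeMatrix v)ᵀ * edgeMatrix v).det := by
  rw [area_simplex, div_pos_iff_of_pos_right (by positivity), Real.sqrt_pos]

end EdgeMap

/-! ### Determinants, dual quadratic forms and altitudes. -/

section LinearAlgebra

open scoped MatrixOrder in
theorem exists_transpose_mul_self {n : ℕ} {A : Matrix (Fin n) (Fin n) ℝ} (hA : A.PosSemidef) :
    ∃ B : Matrix (Fin n) (Fin n) ℝ, A = Bᵀ * B := by
  obtain ⟨B, rfl⟩ := CStarAlgebra.nonneg_iff_eq_star_mul_self.mp hA.nonneg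
  exact ⟨B, by rw [Matrix.star_eq_conjTranspose, Matrix.conjTranspose_eq_transpose_of_trivial]⟩

/-- The inequality of the arithmetic and geometric means, for the eigenvalues. -/
theorem det_le_trace_div_pow {n : ℕ} (hn : n ≠ 0) {A : Matrix (Fin n) (Fin n) ℝ}
    (hA : A.PosSemidef) : A.det ≤ (A.trace / n) ^ n := by
  have h := Real.geom_mean_le_arith_mean Finset.univ (fun _ => (1 : ℝ)) hA.1.eigenvalues
    (fun _ _ => zero_le_one) (by simpa using Nat.pos_of_ne_zero hn)
    (fun i _ => hA.eigenvalues_nonneg i)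
  have hdet : A.det = ∏ i, hA.1.eigenvalues i := by simpa using hA.1.det_eq_prod_eigenvalues
  have htr : A.trace = ∑ i, hA.1.eigenvalues i := by simpa using hA.1.trace_eq_sum_eigenvalues
  simp only [Real.rpow_one, one_mul, Finset.sum_const, Finset.card_univ, Fintype.card_fin,
    nsmul_eq_mul, mul_one, ← hdet, ← htr] at h
  calc A.det = (A.det ^ ((n : ℝ)⁻¹)) ^ n := (Real.rpow_inv_natCast_pow hA.det_nonneg hn).symm
    _ ≤ _ := pow_le_pow_left₀ (Real.rpow_nonneg hA.det_nonneg _) h n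

theorem posSemidef_iff_real {m : ℕ} {A : Matrix (Fin m) (Fin m) ℝ} :
    A.PosSemidef ↔ A.IsSymm ∧ ∀ x, 0 ≤ x ⬝ᵥ A *ᵥ x := by
  rw [Matrix.posSemidef_iff_dotProduct_mulVec, Matrix.isHermitian_iff_isSymm]
  simp

theorem posDef_iff_real {m : ℕ} {A : Matrix (Fin m) (Fin m) ℝ} :
    A.PosDef ↔ A.IsSymm ∧ ∀ x, x ≠ 0 → 0 < x ⬝ᵥ A *ᵥ x := by
  rw [Matrix.posDef_iff_dotProduct_mulVec, Matrix.isHermitian_iff_isSymm]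
  simp

theorem dotProduct_transpose_mul_mul {m n : ℕ} (A : Matrix (Fin m) (Fin m) ℝ)
    (E : Matrix (Fin m) (Fin n) ℝ) (x : Fin n → ℝ) :
    x ⬝ᵥ (Eᵀ * A * E) *ᵥ x = (E *ᵥ x) ⬝ᵥ A *ᵥ (E *ᵥ x) := by
  rw [Matrix.mul_assoc, ← Matrix.mulVec_mulVec, Matrix.dotProduct_mulVec,
    Matrix.vecMul_transpose, Matrix.mulVec_mulVec]

theorem PosSemidef.transpose_mul_mul {m n : ℕ} {A : Matrix (Fin m) (Fin m) ℝ}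
    (hA : A.PosSemidef) (E : Matrix (Fin m) (Fin n) ℝ) : (Eᵀ * A * E).PosSemidef := by
  simpa using hA.conjTranspose_mul_mul_same E

theorem mulVec_injective_of_det_ne_zero {m n : ℕ} {E : Matrix (Fin m) (Fin n) ℝ}
    (hE : (Eᵀ * E).det ≠ 0) : Function.Injective E.mulVec := by
  intro x y hxy
  have h : (Eᵀ * E) *ᵥ x = (Eᵀ * E) *ᵥ y := by
    rw [← Matrix.mulVec_mulVec, ← Matrix.mulVec_mulVec]
    exact congrArg _ hxy
  exact Matrix.mulVec_injective_of_isUnit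
    ((Matrix.isUnit_iff_isUnit_det _).2 (isUnit_iff_ne_zero.2 hE)) h

theorem PosDef.transpose_mul_mul {m n : ℕ} {A : Matrix (Fin m) (Fin m) ℝ}
    (hA : A.PosDef) {E : Matrix (Fin m) (Fin n) ℝ} (hE : (Eᵀ * E).det ≠ 0) :
    (Eᵀ * A * E).PosDef := by
  simpa using hA.conjTranspose_mul_mul_same (mulVec_injective_of_det_ne_zero hE)

/-- The determinant is monotone on positive semidefinite matrices. -/
theorem det_le_det_add {n : ℕ} {H R : Matrix (Fin n) (Fin n) ℝ} (hH : H.PosDef)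
    (hR : R.PosSemidef) : H.det ≤ (H + R).det := by
  rcases eq_or_ne n 0 with rfl | hn
  · simp
  have hS : (H + R).PosDef := hH.add_posSemidef hR
  obtain ⟨B, hB⟩ := exists_transpose_mul_self hS.posSemidef
  have hdet : (H + R).det = B.det ^ 2 := by rw [hB, Matrix.det_mul, Matrix.det_transpose]; ring
  have hB0 : B.det ≠ 0 := fun h => by simpa [hdet, h] using hS.det_pos
  have hBu : IsUnit B.det := isUnit_iff_ne_zero.2 hB0
  -- Congruence by B⁻¹ turns H + R into the identity, so tr W ≤ n, and the inequality of the means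
  -- gives det W ≤ 1.
  set W := (B⁻¹)ᵀ * H * B⁻¹ with hW
  have hWp : W.PosSemidef := PosSemidef.transpose_mul_mul hH.posSemidef _
  have hVp : ((B⁻¹)ᵀ * R * B⁻¹).PosSemidef := PosSemidef.transpose_mul_mul hR _
  have hsum : W + (B⁻¹)ᵀ * R * B⁻¹ = 1 := by
    rw [hW, ← Matrix.add_mul, ← Matrix.mul_add, hB, Matrix.mul_assoc, Matrix.mul_assoc,
      Matrix.mul_nonsing_inv _ hBu, Matrix.mul_one, ← Matrix.transpose_mul,
      Matrix.mul_nonsing_inv _ hBu, Matrix.transpose_one]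
  have htr : W.trace ≤ n := by
    have := congrArg Matrix.trace hsum
    rw [Matrix.trace_add, Matrix.trace_one, Fintype.card_fin] at this
    linarith [hVp.trace_nonneg]
  have hn' : (0 : ℝ) < n := by exact_mod_cast Nat.pos_of_ne_zero hn
  have hWdet : W.det ≤ 1 := by
    refine (det_le_trace_div_pow hn hWp).trans ?_
    refine pow_le_one₀ (div_nonneg hWp.trace_nonneg hn'.le) ?_
    rwa [div_le_one hn']
  have : H.det = W.det * B.det ^ 2 := by
    rw [hW, Matrix.det_mul, Matrix.det_mul, Matrix.det_transpose, Matrix.det_nonsing_inv,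
      Ring.inverse_eq_inv']
    field_simp
  rw [this, hdet]
  nlinarith [sq_nonneg B.det]

/-- The Cauchy-Schwarz inequality between a quadratic form and its dual. -/
theorem one_le_mul_of_dotProduct_eq_one {n : ℕ} {H : Matrix (Fin n) (Fin n) ℝ} (hH : H.PosDef)
    {c u : Fin n → ℝ} (hcu : c ⬝ᵥ u = 1) : 1 ≤ (u ⬝ᵥ H *ᵥ u) * (c ⬝ᵥ H⁻¹ *ᵥ c) := by
  have hc : c ≠ 0 := by rintro rfl; simp at hcu
  have hQ := (posDef_iff_real.1 hH.inv).2 c hc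
  set Q := c ⬝ᵥ H⁻¹ *ᵥ c
  have hHu : IsUnit H.det := isUnit_iff_ne_zero.2 hH.det_pos.ne'
  have hHs : H.IsSymm := (posDef_iff_real.1 hH).1
  -- Q⁻¹ H⁻¹ c minimises the form H on the hyperplane c ⬝ u = 1; nonnegativity at the difference
  -- from u reads uᵀHu ≥ Q⁻¹.
  have key := (posSemidef_iff_real.1 hH.posSemidef).2 (u - Q⁻¹ • (H⁻¹ *ᵥ c))
  have e1 : H *ᵥ (H⁻¹ *ᵥ c) = c := by
    rw [Matrix.mulVec_mulVec, Matrix.mul_nonsing_inv _ hHu, Matrix.one_mulVec]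
  have e2 : (H⁻¹ *ᵥ c) ⬝ᵥ H *ᵥ u = 1 := by
    rw [Matrix.dotProduct_mulVec, ← Matrix.mulVec_transpose, hHs, e1, hcu]
  rw [Matrix.mulVec_sub, Matrix.mulVec_smul, e1] at key
  simp only [sub_dotProduct, dotProduct_sub, smul_dotProduct, dotProduct_smul, e2, smul_eq_mul,
    dotProduct_comm u c, hcu, dotProduct_comm (H⁻¹ *ᵥ c) c] at key
  change 0 ≤ u ⬝ᵥ H *ᵥ u - Q⁻¹ * 1 - Q⁻¹ * (1 - Q⁻¹ * Q) at key
  rw [inv_mul_cancel₀ hQ.ne'] at key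
  have : Q⁻¹ ≤ u ⬝ᵥ H *ᵥ u := by linarith
  calc (1 : ℝ) = Q⁻¹ * Q := (inv_mul_cancel₀ hQ.ne').symm
    _ ≤ _ := mul_le_mul_of_nonneg_right this hQ.le

/-- The linear parts of the barycentric coordinates of the corner simplex. -/
def coordForm {n : ℕ} (j : Fin (n + 1)) : Fin n → ℝ :=
  Fin.cons (α := fun _ => Fin n → ℝ) (fun _ => -1) (fun i => Pi.single i 1) j

@[simp] theorem coordForm_zero {n : ℕ} : coordForm (0 : Fin (n + 1)) = fun _ => -1 := rfl

@[simp] theorem coordForm_succ {n : ℕ} (i : Fin n) : coordForm i.succ = Pi.single i 1 := rfl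

/-- The barycentric coordinates add up to the constant 1, so their linear parts cancel. -/
theorem sum_coordForm (n : ℕ) : ∑ j : Fin (n + 1), coordForm j = 0 := by
  ext i
  simp [Fin.sum_univ_succ, Pi.single_apply]

/-- In an inner product, the squared length of one of `n + 1` vectors with sum zero is at most
`n / (n + 1)` times the sum of all of them. -/
theorem coordForm_le_sum {n : ℕ} {K : Matrix (Fin n) (Fin n) ℝ} (hK : K.PosSemidef)
    (j : Fin (n + 1)) :
    ((n : ℝ) + 1) * (coordForm j ⬝ᵥ K *ᵥ coordForm j) ≤
      n * ∑ i : Fin (n + 1), coordForm i ⬝ᵥ K *ᵥ coordForm i := by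
  obtain ⟨B, rfl⟩ := exists_transpose_mul_self hK
  have hq : ∀ i : Fin (n + 1), coordForm i ⬝ᵥ (Bᵀ * B) *ᵥ coordForm i =
      ∑ r, (B *ᵥ coordForm i) r ^ 2 := fun i => by
    have := dotProduct_transpose_mul_mul 1 B (coordForm i)
    rw [Matrix.mul_one, Matrix.one_mulVec] at this
    rw [this, dotProduct]
    exact Finset.sum_congr rfl fun r _ => (sq _).symm
  simp only [hq]
  rw [Finset.sum_comm, Finset.mul_sum, Finset.mul_sum]
  refine Finset.sum_le_sum fun r _ => ?_
  have hsum : ∑ i : Fin (n + 1), (B *ᵥ coordForm i) r = 0 := by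
    have := congrArg (fun c => (B *ᵥ c) r) (sum_coordForm n)
    simpa [Matrix.mulVec_sum, Finset.sum_apply] using this
  rw [← Finset.add_sum_erase _ _ (Finset.mem_univ j)] at hsum ⊢
  -- In each component r, the entry for j is minus the sum of the n others, so its square is at most
  -- n times the sum of their squares.
  have hcs := sq_sum_le_card_mul_sum_sq (s := Finset.univ.erase j)
    (f := fun i => (B *ᵥ coordForm i) r)
  rw [Finset.card_erase_of_mem (Finset.mem_univ j), Finset.card_univ, Fintype.card_fin,
    Nat.add_sub_cancel, show ∑ i ∈ Finset.univ.erase j, (B *ᵥ coordForm i) r =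
      -(B *ᵥ coordForm j) r by linarith] at hcs
  linarith

/-- The right side is the trace of (1 + all-ones) K, and 1 + all-ones is, up to scale, the Gram
matrix of an equilateral simplex. -/
theorem sum_coordForm_quad {n : ℕ} (K : Matrix (Fin n) (Fin n) ℝ) :
    ∑ i : Fin (n + 1), coordForm i ⬝ᵥ K *ᵥ coordForm i = K.trace + ∑ i, ∑ j, K i j := by
  rw [Fin.sum_univ_succ, add_comm]
  congr 1
  · simp [Matrix.trace]
  · simp [dotProduct, Matrix.mulVec]

/-- The difference of a vertex and a point of the opposite facet. -/
theorem exists_edgeMap_eq {n k : ℕ} (v : Fin (n + 1) → Pt k) (j : Fin (n + 1)) {y : Pt k}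
    (hy : y ∈ affineSpan ℝ (v '' {j}ᶜ)) :
    ∃ u : Pt n, v j - y = edgeMap v u ∧ coordForm j ⬝ᵥ u.ofLp = 1 := by
  -- The j-th barycentric coordinate falls from 1 at vertex j to 0 on the opposite facet. The claim
  -- is affine in y, so it suffices to check the other vertices.
  refine affineSpan_induction (p := fun y => ∃ u : Pt n, v j - y = edgeMap v u ∧
    coordForm j ⬝ᵥ u.ofLp = 1) hy ?_ ?_
  · rintro _ ⟨i, hi, rfl⟩
    have hij : i ≠ j := hi
    have hE : ∀ l : Fin n, edgeMap v (EuclideanSpace.single l 1) = v l.succ - v 0 := fun l => by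
      simp [edgeMap_apply, PiLp.single_apply]
    induction j using Fin.cases with
    | zero =>
      obtain ⟨l, rfl⟩ := Fin.exists_succ_eq.2 hij
      refine ⟨-EuclideanSpace.single l 1, by simp [hE], ?_⟩
      simp [dotProduct]
    | succ m =>
      induction i using Fin.cases with
      | zero => exact ⟨EuclideanSpace.single m 1, by simp [hE], by simp⟩
      | succ l =>
        have hlm : l ≠ m := fun h => hij (by rw [h])
        refine ⟨EuclideanSpace.single m 1 - EuclideanSpace.single l 1, by simp [hE], ?_⟩
        simp [hlm.symm]
  · rintro c a b w ⟨ua, hua, hua1⟩ ⟨ub, hub, hub1⟩ ⟨uw, huw, huw1⟩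
    refine ⟨uw - c • (ub - ua), ?_, ?_⟩
    · rw [map_sub, map_smul, map_sub, ← hua, ← hub, ← huw, vsub_eq_sub, vadd_eq_add]
      module
    · rw [WithLp.ofLp_sub, WithLp.ofLp_smul, WithLp.ofLp_sub, dotProduct_sub, dotProduct_smul,
        dotProduct_sub, hua1, hub1, huw1]
      simp

/-- The dual form at `coordForm j` is the inverse square of the j-th altitude; only one inequality
is needed, and it is Cauchy-Schwarz. -/
theorem le_minAltitude {n : ℕ} {A : Matrix (Fin (n + 1)) (Fin (n + 1)) ℝ}
    {v : Fin (n + 1) → Pt (n + 1)}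
    (hH : ((edgeMatrix v)ᵀ * A * edgeMatrix v).PosDef) (hn : n ≠ 0) {a : ℝ}
    (hQ : ∀ j, a ^ 2 * (coordForm j ⬝ᵥ ((edgeMatrix v)ᵀ * A * edgeMatrix v)⁻¹ *ᵥ coordForm j) ≤ 1) :
    a ≤ minAltitude A v := by
  refine le_ciInf fun j => ?_
  -- With a single vertex the opposite facet would be empty and the infimum would take its default
  -- value 0.
  have : Nontrivial (Fin (n + 1)) := Fin.nontrivial_iff_two_le.2 (by lia)
  obtain ⟨i, hi⟩ := exists_ne j
  have : Nonempty (affineSpan ℝ (v '' {j}ᶜ)) := ⟨⟨v i, subset_affineSpan ℝ _ ⟨i, hi, rfl⟩⟩⟩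
  refine le_ciInf fun y => ?_
  obtain ⟨u, hu, hcu⟩ := exists_edgeMap_eq v j y.2
  refine Real.le_sqrt_of_sq_le ?_
  rw [hu, edgeMap_ofLp, ← dotProduct_transpose_mul_mul]
  have h1 := one_le_mul_of_dotProduct_eq_one hH hcu
  set Q := coordForm j ⬝ᵥ ((edgeMatrix v)ᵀ * A * edgeMatrix v)⁻¹ *ᵥ coordForm j
  have hc : coordForm j ≠ 0 := by intro h; simp [h] at hcu
  have hQ0 : 0 < Q := (posDef_iff_real.1 hH.inv).2 _ hc
  have := hQ j
  refine le_of_mul_le_mul_right (this.trans h1) hQ0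

/-- The diagonal entries of H⁻¹ are the dual values for j = 1, …, n, so its trace is at most n / a²,
and the inequality of the means bounds its determinant by a^(-2n). -/
theorem pow_le_sqrt_det {n : ℕ} (hn : n ≠ 0) {H : Matrix (Fin n) (Fin n) ℝ} (hH : H.PosDef)
    {a : ℝ} (ha : 0 < a)
    (hQ : ∀ j, a ^ 2 * (coordForm j ⬝ᵥ H⁻¹ *ᵥ coordForm j) ≤ 1) : a ^ n ≤ Real.sqrt H.det := by
  refine Real.le_sqrt_of_sq_le ?_
  have hn' : (0 : ℝ) < n := by exact_mod_cast Nat.pos_of_ne_zero hn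
  have htr : a ^ 2 * (H⁻¹).trace ≤ n := by
    calc a ^ 2 * (H⁻¹).trace = ∑ i : Fin n, a ^ 2 * H⁻¹ i i := by
          rw [Matrix.trace, Finset.mul_sum]; rfl
      _ ≤ ∑ i : Fin n, (1 : ℝ) := Finset.sum_le_sum fun i _ => by simpa using hQ i.succ
      _ = n := by simp
  have hdet := det_le_trace_div_pow hn hH.inv.posSemidef
  rw [Matrix.det_nonsing_inv, Ring.inverse_eq_inv'] at hdet
  have hd := hH.det_pos
  have h1 : (a ^ 2 * ((H⁻¹).trace / n)) ^ n ≤ 1 := by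
    refine pow_le_one₀ ?_ ?_
    · have := hH.inv.posSemidef.trace_nonneg
      positivity
    · rw [← mul_div_assoc]; exact (div_le_one hn').2 htr
  rw [mul_pow] at h1
  have h2 : (a ^ 2) ^ n * H.det⁻¹ ≤ 1 :=
    (mul_le_mul_of_nonneg_left hdet (by positivity)).trans h1
  rw [mul_inv_le_iff₀ hd, one_mul] at h2
  calc (a ^ n) ^ 2 = (a ^ 2) ^ n := by ring
    _ ≤ _ := h2

/-- The Gram matrix of the edges of an equilateral simplex. -/
theorem IsEquilateral.gram {n : ℕ} {ξ : Fin (n + 1) → Pt n} (hξ : IsEquilateral ξ) :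
    ∃ σ : ℝ, 0 ≤ σ ∧
      (edgeMatrix ξ)ᵀ * edgeMatrix ξ = σ • (1 + Matrix.of fun _ _ => (1 : ℝ)) := by
  obtain ⟨s, hs⟩ := hξ
  -- Two distinct edges of length s from a common vertex, whose endpoints are again s apart, have
  -- inner product s² / 2.
  refine ⟨s ^ 2 / 2, by positivity, ?_⟩
  ext i j
  have hij : ((edgeMatrix ξ)ᵀ * edgeMatrix ξ) i j =
      inner ℝ (ξ i.succ - ξ 0) (ξ j.succ - ξ 0) := by
    simp [Matrix.mul_apply, edgeMatrix, PiLp.inner_apply, mul_comm]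
  have hnorm : ∀ l : Fin n, ‖ξ l.succ - ξ 0‖ = s := fun l => by
    rw [← dist_eq_norm]; exact hs _ _ (Fin.succ_ne_zero l)
  rw [hij]
  by_cases h : i = j
  · subst h
    rw [real_inner_self_eq_norm_sq, hnorm]
    simp
    ring
  · have h2 : ‖(ξ i.succ - ξ 0) - (ξ j.succ - ξ 0)‖ = s := by
      rw [sub_sub_sub_cancel_right, ← dist_eq_norm]
      exact hs _ _ fun h' => h (Fin.succ_injective _ h')
    rw [real_inner_eq_norm_mul_self_add_norm_mul_self_sub_norm_sub_mul_self_div_two, hnorm, hnorm,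
      h2]
    simp [h]
    ring

theorem det_one_add_ones (n : ℕ) :
    (1 + Matrix.of fun _ _ => (1 : ℝ) : Matrix (Fin n) (Fin n) ℝ).det = n + 1 := by
  have h := Matrix.det_one_add_replicateCol_mul_replicateRow (ι := Unit)
    (fun _ : Fin n => (1 : ℝ)) (fun _ => 1)
  have e : Matrix.replicateCol Unit (fun _ : Fin n => (1 : ℝ)) *
      Matrix.replicateRow Unit (fun _ : Fin n => (1 : ℝ)) = Matrix.of fun _ _ => (1 : ℝ) := by
    ext i j; simp [Matrix.mul_apply]
  rw [e] at h
  rw [h]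
  simp [dotProduct, add_comm]

end LinearAlgebra

/-! ### From a bound for one energy term to the altitudes of its element. -/

section ElementBound

/-- This is exactly the slack between the constant that the argument yields and the stated `C1`; it
is an equality for n = 1. -/
theorem succ_pow_pred_le {n : ℕ} (hn : n ≠ 0) : (n + 1) ^ (n - 1) ≤ n ^ (3 * n) := by
  rcases Nat.lt_or_ge n 2 with h | h
  · obtain rfl : n = 1 := by lia
    simp
  · calc (n + 1) ^ (n - 1) ≤ (n + 1) ^ n := Nat.pow_le_pow_right (by lia) (by lia)
      _ ≤ (n ^ 3) ^ n := Nat.pow_le_pow_left (by nlinarith [Nat.pow_le_pow_left h 2]) n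
      _ = n ^ (3 * n) := (pow_mul n 3 n).symm

/-- The lower bound for the altitudes, as a function of the bound `B` for the energy. -/
noncomputable def altitudeBound (d N : ℕ) (α q B : ℝ) : ℝ :=
  C1 d α q * B ^ (-(1 / (2 * q - d + 1))) *
    (N : ℝ) ^ (-(2 * q / (((d : ℝ) - 1) * (2 * q - d + 1))))

theorem C1_pos {d : ℕ} (hd : 2 ≤ d) {α q : ℝ} (hα : 0 < α) : 0 < C1 d α q := by
  have h1 : (0 : ℝ) < (d : ℝ) - 1 := by
    have : (2 : ℝ) ≤ d := by exact_mod_cast hd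
    linarith
  have h2 : (0 : ℝ) < d := by linarith
  have h3 : (0 : ℝ) < (Nat.factorial (d - 1) : ℝ) := by positivity
  unfold C1
  positivity

theorem altitudeBound_pos {d N : ℕ} (hd : 2 ≤ d) (hN : 0 < N) {α q B : ℝ} (hα : 0 < α)
    (hB : 0 < B) : 0 < altitudeBound d N α q B := by
  have := C1_pos hd (q := q) hα
  have : (0 : ℝ) < N := by exact_mod_cast hN
  unfold altitudeBound
  positivity

theorem log_altitudeBound {n N : ℕ} (hn : n ≠ 0) (hN : 0 < N) {α q B : ℝ} (hα : 0 < α)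
    (hB : 0 < B) :
    Real.log (altitudeBound (n + 1) N α q B) =
      1 / (2 * q - n) * (Real.log α + q * ((n : ℝ) - 1) / n * Real.log (n + 1) +
        (2 * q - n) / n * Real.log n.factorial - (n + 2 * q) / 2 * Real.log n) -
      1 / (2 * q - n) * Real.log B - 2 * q / (n * (2 * q - n)) * Real.log N := by
  have hn' : (0 : ℝ) < n := by exact_mod_cast Nat.pos_of_ne_zero hn
  have hd : (0 : ℝ) < (n : ℝ) + 1 := by linarith
  have hN' : (0 : ℝ) < N := by exact_mod_cast hN
  have hf : (0 : ℝ) < (n.factorial : ℝ) := by positivity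
  have hC := C1_pos (d := n + 1) (by lia) (q := q) hα
  have e1 : 2 * q - ((n + 1 : ℕ) : ℝ) + 1 = 2 * q - n := by push_cast; ring
  have e2 : ((n + 1 : ℕ) : ℝ) - 1 = n := by push_cast; ring
  have e3 : ((n + 1 : ℕ) : ℝ) - 2 = n - 1 := by push_cast; ring
  unfold altitudeBound
  rw [Real.log_mul (by positivity) (by positivity), Real.log_mul hC.ne' (by positivity),
    Real.log_rpow hB, Real.log_rpow hN']
  unfold C1
  rw [e1, e2, e3, Nat.add_sub_cancel, Nat.cast_succ, Real.log_rpow (by positivity),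
    Real.log_div (by positivity) (by positivity), Real.log_mul (by positivity) (by positivity),
    Real.log_mul (by positivity) (by positivity), Real.log_rpow hd, Real.log_rpow hf,
    Real.log_rpow hn']
  ring

/-- Here h is the root of det A for the pulled-back metric A, t the trace of A⁻¹, and Q a dual value
of H. All relations are between monomials, so after taking logarithms the claim is linear: h is
eliminated by the inequality of the means, then t and σ. -/
theorem altitudeBound_sq_mul_le {n N : ℕ} (hn : n ≠ 0) (hN : 0 < N) {α q B h t σ Q : ℝ}
    (hα : 0 < α) (hh : 0 < h) (ht : 0 < t) (hσ : 0 < σ) (hQ : 0 < Q)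
    (hq : (n : ℝ) / 2 < q) (hE : α * (1 / N * h * t ^ q) ≤ B)
    (hamgm : 1 ≤ (t / n) ^ n * h ^ 2) (htQ : σ * ((n + 1) * Q) ≤ n * t)
    (hσn : σ ^ n * (n + 1) = ((n.factorial : ℝ) / N) ^ 2) :
    altitudeBound (n + 1) N α q B ^ 2 * Q ≤ 1 := by
  have hn' : (0 : ℝ) < n := by exact_mod_cast Nat.pos_of_ne_zero hn
  have hd : (0 : ℝ) < (n : ℝ) + 1 := by linarith
  have hN' : (0 : ℝ) < N := by exact_mod_cast hN
  have hf : (0 : ℝ) < (n.factorial : ℝ) := by positivity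
  have hB : 0 < B := lt_of_lt_of_le (by positivity) hE
  have hp : 0 < 2 * q - n := by linarith
  have ha := altitudeBound_pos (d := n + 1) (by lia) hN (q := q) hα hB
  rw [← Real.log_nonpos_iff (by positivity), Real.log_mul (by positivity) hQ.ne', Real.log_pow,
    log_altitudeBound hn hN hα hB]
  have l1 := Real.log_le_log (by positivity) hE
  rw [Real.log_mul hα.ne' (by positivity), Real.log_mul (by positivity) (by positivity),
    Real.log_mul (by positivity) hh.ne', one_div, Real.log_inv, Real.log_rpow ht] at l1
  have l2 := Real.log_le_log one_pos hamgm
  rw [Real.log_one, Real.log_mul (by positivity) (by positivity), Real.log_pow, Real.log_pow,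
    Real.log_div ht.ne' hn'.ne'] at l2
  have l3 := Real.log_le_log (by positivity) htQ
  rw [Real.log_mul hσ.ne' (by positivity), Real.log_mul hd.ne' hQ.ne',
    Real.log_mul hn'.ne' ht.ne'] at l3
  have l4 := congrArg Real.log hσn
  rw [Real.log_mul (by positivity) hd.ne', Real.log_pow, Real.log_pow,
    Real.log_div hf.ne' hN'.ne'] at l4
  have l5 : ((n : ℝ) - 1) * Real.log (n + 1) ≤ 3 * n * Real.log n := by
    have h5 : ((n : ℝ) + 1) ^ (n - 1) ≤ (n : ℝ) ^ (3 * n) := by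
      exact_mod_cast succ_pow_pred_le hn
    have := Real.log_le_log (by positivity) h5
    rw [Real.log_pow, Real.log_pow, Nat.cast_sub (Nat.pos_of_ne_zero hn)] at this
    push_cast at this
    exact this
  push_cast at l2 l4 ⊢
  generalize Real.log α = A at *
  generalize Real.log B = LB at *
  generalize Real.log h = Lh at *
  generalize Real.log t = Lt at *
  generalize Real.log σ = Lσ at *
  generalize Real.log Q = LQ at *
  generalize Real.log N = LN at *
  generalize Real.log n = Ln at *
  generalize Real.log ((n : ℝ) + 1) = Ld at *
  generalize Real.log (n.factorial : ℝ) = Lf at *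
  have l3' := mul_le_mul_of_nonneg_left l3 hp.le
  -- Up to clearing denominators this is 2·`l1` + `l2` + (2q - n)·`l3` + `l5`, with log σ taken from
  -- `l4`.
  have key : (2 * q - n) * LQ + 2 * (A + q * ((n : ℝ) - 1) / n * Ld +
      (2 * q - n) / n * Lf - (n + 2 * q) / 2 * Ln - LB - 2 * q / n * LN) ≤ 0 := by
    have hLσ : Lσ = (2 * (Lf - LN) - Ld) / n := by field_simp; linarith
    subst hLσ
    field_simp at l3' ⊢
    nlinarith
  have : 2 * (1 / (2 * q - n) * (A + q * ((n : ℝ) - 1) / n * Ld + (2 * q - n) / n * Lf -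
      (n + 2 * q) / 2 * Ln) - 1 / (2 * q - n) * LB - 2 * q / (n * (2 * q - n)) * LN) + LQ =
      ((2 * q - n) * LQ + 2 * (A + q * ((n : ℝ) - 1) / n * Ld +
      (2 * q - n) / n * Lf - (n + 2 * q) / 2 * Ln - LB - 2 * q / n * LN)) / (2 * q - n) := by
    field_simp
    ring
  rw [this]
  exact div_nonpos_of_nonpos_of_nonneg key hp.le

variable {n : ℕ}

theorem pullback_eq (ξ : Fin (n + 1) → Pt n) (M : Pt (n + 1) → Matrix (Fin (n + 1)) (Fin (n + 1)) ℝ)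
    (v : Fin (n + 1) → Pt (n + 1)) :
    pullback ξ M v = ((edgeMatrix ξ)⁻¹)ᵀ *
      ((edgeMatrix v)ᵀ * avgMetric M v * edgeMatrix v) * (edgeMatrix ξ)⁻¹ := by
  simp only [pullback, jacobian, Matrix.transpose_mul, Matrix.mul_assoc]

theorem area_reference (ξ : Fin (n + 1) → Pt n) :
    area n (simplex ξ) = |(edgeMatrix ξ).det| / n.factorial := by
  rw [area_simplex, Matrix.det_mul, Matrix.det_transpose, Real.sqrt_mul_self_eq_abs]

section
variable {ξ : Fin (n + 1) → Pt n}
  (M : Pt (n + 1) → Matrix (Fin (n + 1)) (Fin (n + 1)) ℝ) {v : Fin (n + 1) → Pt (n + 1)}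

theorem det_pullback (hξ : (edgeMatrix ξ).det ≠ 0) : (pullback ξ M v).det =
    ((edgeMatrix v)ᵀ * avgMetric M v * edgeMatrix v).det / (edgeMatrix ξ).det ^ 2 := by
  rw [pullback_eq, Matrix.det_mul, Matrix.det_mul, Matrix.det_transpose, Matrix.det_nonsing_inv,
    Ring.inverse_eq_inv']
  field_simp

/-- The reference element cancels: the weight of an element in the energy is its area in the
averaged metric. -/
theorem area_mul_sqrt_det_pullback (hξ : (edgeMatrix ξ).det ≠ 0) : area n (simplex ξ) * Real.sqrt (pullback ξ M v).det =
    Real.sqrt ((edgeMatrix v)ᵀ * avgMetric M v * edgeMatrix v).det / n.factorial := by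
  have : |(edgeMatrix ξ).det| ≠ 0 := abs_ne_zero.2 hξ
  rw [det_pullback M hξ, area_reference, Real.sqrt_div' _ (sq_nonneg _), Real.sqrt_sq_eq_abs]
  field_simp

theorem pullback_posDef (hξ : (edgeMatrix ξ).det ≠ 0) (hH : ((edgeMatrix v)ᵀ * avgMetric M v * edgeMatrix v).PosDef) :
    (pullback ξ M v).PosDef := by
  rw [pullback_eq]
  refine PosDef.transpose_mul_mul hH ?_
  rw [Matrix.det_mul, Matrix.det_transpose, Matrix.det_nonsing_inv, Ring.inverse_eq_inv']
  positivity

theorem pullback_inv (hξ : (edgeMatrix ξ).det ≠ 0) :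
    (pullback ξ M v)⁻¹ = edgeMatrix ξ * ((edgeMatrix v)ᵀ * avgMetric M v * edgeMatrix v)⁻¹ *
      (edgeMatrix ξ)ᵀ := by
  rw [pullback_eq, Matrix.mul_inv_rev, Matrix.mul_inv_rev,
    Matrix.nonsing_inv_nonsing_inv _ (isUnit_iff_ne_zero.2 hξ), ← Matrix.transpose_nonsing_inv,
    Matrix.nonsing_inv_nonsing_inv _ (isUnit_iff_ne_zero.2 hξ), ← Matrix.mul_assoc]

/-- Cyclicity of the trace brings in the Gram matrix of the reference edges. For an equilateral
reference it weighs all n + 1 barycentric coordinates equally. -/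
theorem trace_pullback_inv (hξ : (edgeMatrix ξ).det ≠ 0) {σ : ℝ}
    (hσ : (edgeMatrix ξ)ᵀ * edgeMatrix ξ = σ • (1 + Matrix.of fun _ _ => (1 : ℝ))) :
    (pullback ξ M v)⁻¹.trace = σ * ∑ j : Fin (n + 1), coordForm j ⬝ᵥ
      ((edgeMatrix v)ᵀ * avgMetric M v * edgeMatrix v)⁻¹ *ᵥ coordForm j := by
  rw [pullback_inv M hξ, Matrix.trace_mul_comm, ← Matrix.mul_assoc, hσ, sum_coordForm_quad,
    Matrix.smul_mul, Matrix.trace_smul, Matrix.add_mul, Matrix.one_mul, Matrix.trace_add,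
    smul_eq_mul]
  congr 2
  simp only [Matrix.trace, Matrix.diag_apply, Matrix.mul_apply, Matrix.of_apply, one_mul]
  rw [Finset.sum_comm]

end

/-- A bound for the contribution of an element to the energy bounds its altitudes from below. -/
theorem altitudeBound_sq_mul_coordForm_le (hn : n ≠ 0) {N : ℕ} (hN : 0 < N)
    {ξ : Fin (n + 1) → Pt n} (hξ : IsEquilateral ξ) (hξN : area n (simplex ξ) = 1 / N)
    (M : Pt (n + 1) → Matrix (Fin (n + 1)) (Fin (n + 1)) ℝ) {v : Fin (n + 1) → Pt (n + 1)}
    (hH : ((edgeMatrix v)ᵀ * avgMetric M v * edgeMatrix v).PosDef) {α q B : ℝ} (hα : 0 < α)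
    (hq : (n : ℝ) / 2 < q)
    (hE : α * (area n (simplex ξ) * Real.sqrt (pullback ξ M v).det *
      (pullback ξ M v)⁻¹.trace ^ q) ≤ B) (j : Fin (n + 1)) :
    altitudeBound (n + 1) N α q B ^ 2 * (coordForm j ⬝ᵥ
      ((edgeMatrix v)ᵀ * avgMetric M v * edgeMatrix v)⁻¹ *ᵥ coordForm j) ≤ 1 := by
  have hn' : (0 : ℝ) < n := by exact_mod_cast Nat.pos_of_ne_zero hn
  have hN' : (0 : ℝ) < N := by exact_mod_cast hN
  have hfac : (0 : ℝ) < n.factorial := by positivity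
  have hdetN : |(edgeMatrix ξ).det| = n.factorial / N := by
    rw [area_reference] at hξN
    field_simp at hξN ⊢
    linarith
  have hξ0 : (edgeMatrix ξ).det ≠ 0 := abs_pos.1 (hdetN ▸ by positivity)
  obtain ⟨σ, hσ0, hσ⟩ := hξ.gram
  -- The prescribed area 1 / N of the reference element fixes the scale σ; this is how N enters the
  -- bounds.
  have hσn : σ ^ n * (n + 1) = ((n.factorial : ℝ) / N) ^ 2 := by
    have := congrArg Matrix.det hσ
    rw [Matrix.det_smul, det_one_add_ones, Fintype.card_fin, Matrix.det_mul, Matrix.det_transpose,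
      ← sq, ← sq_abs, hdetN] at this
    exact this.symm
  have hσpos : 0 < σ := by
    refine lt_of_le_of_ne hσ0 fun h => ?_
    rw [← h, zero_pow hn, zero_mul] at hσn
    have : 0 < ((n.factorial : ℝ) / N) ^ 2 := by positivity
    linarith
  have hA := pullback_posDef M hξ0 hH
  have hJ := hA.inv
  have : Nonempty (Fin n) := ⟨⟨0, Nat.pos_of_ne_zero hn⟩⟩
  have hc : (coordForm j : Fin n → ℝ) ≠ 0 := by
    induction j using Fin.cases with
    | zero => exact fun h => by simpa using congrFun h (Classical.arbitrary _)
    | succ i => exact fun h => by simpa using congrFun h i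
  have hQ := (posDef_iff_real.1 hH.inv).2 _ hc
  refine altitudeBound_sq_mul_le hn hN hα (Real.sqrt_pos.2 hA.det_pos) hJ.trace_pos hσpos hQ hq
    (hξN ▸ hE) ?_ ?_ hσn
  · have := det_le_trace_div_pow hn hJ.posSemidef
    rw [Matrix.det_nonsing_inv, Ring.inverse_eq_inv', inv_le_iff_one_le_mul₀ hA.det_pos] at this
    rwa [Real.sq_sqrt hA.det_pos.le]
  · rw [trace_pullback_inv M hξ0 hσ]
    have := mul_le_mul_of_nonneg_left (coordForm_le_sum hH.inv.posSemidef j) hσ0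
    linarith

/-- The area in the metric `A ≤ m I` is at most `m ^ (n / 2)` times the Euclidean area. -/
theorem sqrt_det_le_rpow_mul {A : Matrix (Fin (n + 1)) (Fin (n + 1)) ℝ}
    {E : Matrix (Fin (n + 1)) (Fin n) ℝ} {m : ℝ} (hm : 0 < m)
    (hA : (Eᵀ * A * E).PosDef) (hAm : (m • (1 : Matrix _ _ ℝ) - A).PosSemidef) :
    Real.sqrt (Eᵀ * A * E).det ≤ m ^ ((n : ℝ) / 2) * Real.sqrt (Eᵀ * E).det := by
  have h := det_le_det_add hA (PosSemidef.transpose_mul_mul hAm E)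
  have e : Eᵀ * A * E + Eᵀ * (m • (1 : Matrix _ _ ℝ) - A) * E = m • (Eᵀ * E) := by
    rw [← Matrix.add_mul, ← Matrix.mul_add, add_sub_cancel, Matrix.mul_smul, Matrix.mul_one,
      Matrix.smul_mul]
  rw [e, Matrix.det_smul, Fintype.card_fin] at h
  calc Real.sqrt (Eᵀ * A * E).det ≤ Real.sqrt (m ^ n * (Eᵀ * E).det) := Real.sqrt_le_sqrt h
    _ = _ := by
      rw [Real.sqrt_mul (by positivity), Real.sqrt_eq_rpow, ← Real.rpow_natCast, ← Real.rpow_mul hm.le]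
      congr 2
      ring

end ElementBound

/-! ### Bounds for the averaged metric. -/

section Average
open MeasureTheory

variable {n : ℕ}

theorem integrableOn_param {k : ℕ} {v : Fin (n + 1) → Pt k} {U : Set (Pt k)} {f : Pt k → ℝ}
    (hf : ContinuousOn f U) (hv : simplex v ⊆ U) :
    IntegrableOn (fun y => f (param v y)) (corner n) := by
  refine ContinuousOn.integrableOn_compact (isCompact_corner n) ?_
  refine hf.comp (continuous_param v).continuousOn fun y hy => hv ?_
  rw [simplex_eq_image]
  exact ⟨y, hy, rfl⟩

theorem param_mem_simplex {k : ℕ} (v : Fin (n + 1) → Pt k) {y : Pt n} (hy : y ∈ corner n) :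
    param v y ∈ simplex v := by
  rw [simplex_eq_image]
  exact ⟨y, hy, rfl⟩

theorem posSemidef_setIntegral {X : Type*} [MeasurableSpace X] {μ : Measure X} {s : Set X}
    (hs : MeasurableSet s) {m : ℕ} {W : X → Matrix (Fin m) (Fin m) ℝ}
    (hW : ∀ i j, IntegrableOn (fun y => W y i j) s μ) (hp : ∀ y ∈ s, (W y).PosSemidef) :
    (Matrix.of fun i j => ∫ y in s, W y i j ∂μ).PosSemidef := by
  rw [posSemidef_iff_real]
  constructor
  · ext i j
    refine setIntegral_congr_fun hs fun y hy => ?_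
    exact (posSemidef_iff_real.1 (hp y hy)).1.apply i j
  · intro x
    have h : x ⬝ᵥ (Matrix.of fun i j => ∫ y in s, W y i j ∂μ) *ᵥ x =
        ∫ y in s, x ⬝ᵥ W y *ᵥ x ∂μ := by
      simp only [dotProduct, Matrix.mulVec, Matrix.of_apply]
      rw [integral_finsetSum]
      · refine Finset.sum_congr rfl fun i _ => ?_
        rw [integral_const_mul, integral_finsetSum]
        · congr 1
          exact Finset.sum_congr rfl fun j _ => (integral_mul_const _ _).symm
        · exact fun j _ => (hW i j).mul_const _
      · exact fun i _ => (integrable_finsetSum _ fun j _ => (hW i j).mul_const _).const_mul _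
    rw [h]
    exact setIntegral_nonneg hs fun y hy => (posSemidef_iff_real.1 (hp y hy)).2 x

theorem setIntegral_corner_const (n : ℕ) (c : ℝ) :
    ∫ _ in corner n, c = c / n.factorial := by
  rw [setIntegral_const, Measure.real, volume_corner, ENNReal.toReal_ofReal (by positivity),
    smul_eq_mul]
  ring

variable {M : Pt (n + 1) → Matrix (Fin (n + 1)) (Fin (n + 1)) ℝ} {U : Set (Pt (n + 1))}
  {v : Fin (n + 1) → Pt (n + 1)}

theorem avgMetric_isSymm (hMs : ∀ y ∈ U, (M y).IsSymm)
    (hv : 0 < ((edgeMatrix v)ᵀ * edgeMatrix v).det) (hvU : simplex v ⊆ U) :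
    (avgMetric M v).IsSymm := by
  ext i j
  rw [Matrix.transpose_apply, avgMetric_apply hv, avgMetric_apply hv]
  congr 1
  exact setIntegral_congr_fun (isClosed_corner n).measurableSet fun y hy =>
    (hMs _ (hvU (param_mem_simplex v hy))).apply i j

/-- Positive semidefiniteness passes through integrals, and constants average to themselves because
the corner simplex has volume 1 / n!. -/
theorem avgMetric_sub_posSemidef (hM : ∀ i j, ContinuousOn (fun y => M y i j) U)
    (hvU : simplex v ⊆ U) {m : ℝ}
    (hMm : ∀ y ∈ simplex v, (M y - m • (1 : Matrix _ _ ℝ)).PosSemidef)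
    (hv : 0 < ((edgeMatrix v)ᵀ * edgeMatrix v).det) :
    (avgMetric M v - m • (1 : Matrix _ _ ℝ)).PosSemidef := by
  have hint : ∀ i j, IntegrableOn (fun y => M (param v y) i j) (corner n) := fun i j =>
    integrableOn_param (hM i j) hvU
  have hfin : volume (corner n) ≠ ⊤ := by rw [volume_corner]; exact ENNReal.ofReal_ne_top
  have h := posSemidef_setIntegral (μ := volume) (isClosed_corner n).measurableSet
    (W := fun y => M (param v y) - m • (1 : Matrix _ _ ℝ))
    (fun i j => (hint i j).sub (integrableOn_const hfin))
    (fun y hy => hMm _ (param_mem_simplex v hy))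
  have hf : (0 : ℝ) < n.factorial := by positivity
  convert! h.smul hf.le using 1
  ext i j
  simp only [Matrix.sub_apply, avgMetric_apply hv, Matrix.smul_apply, Matrix.of_apply, smul_eq_mul]
  rw [integral_sub (hint i j) (integrableOn_const hfin), setIntegral_corner_const]
  field_simp

theorem sub_avgMetric_posSemidef (hM : ∀ i j, ContinuousOn (fun y => M y i j) U)
    (hvU : simplex v ⊆ U) {m : ℝ}
    (hMm : ∀ y ∈ simplex v, (m • (1 : Matrix _ _ ℝ) - M y).PosSemidef)
    (hv : 0 < ((edgeMatrix v)ᵀ * edgeMatrix v).det) :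
    (m • (1 : Matrix _ _ ℝ) - avgMetric M v).PosSemidef := by
  have h := avgMetric_sub_posSemidef (M := fun y => -M y) (m := -m)
    (fun i j => (hM i j).neg) hvU (fun y hy => by simpa [sub_eq_add_neg, add_comm] using hMm y hy)
    hv
  convert! h using 1
  ext i j
  simp only [Matrix.sub_apply, avgMetric_apply hv, Matrix.smul_apply, smul_eq_mul, Matrix.neg_apply,
    integral_neg]
  ring

end Average

/-! ### Differentiability of the energy of an element in its vertices. -/

section Differentiability
open MeasureTheory Filter Topology

variable {n : ℕ}

theorem continuous_baryCoord (j : Fin (n + 1)) : Continuous fun y : Pt n => baryCoord y j := by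
  refine Fin.cases ?_ (fun i => ?_) j
  · simp only [baryCoord, Fin.cons_zero]; fun_prop
  · simp only [baryCoord, Fin.cons_succ]; fun_prop

/-- The parametrisation of a simplex, as a linear function of the vertices. -/
noncomputable def paramCLM (k : ℕ) (y : Pt n) : (Fin (n + 1) → Pt k) →L[ℝ] Pt k :=
  ∑ j, baryCoord y j • ContinuousLinearMap.proj (R := ℝ) (φ := fun _ => Pt k) j

theorem paramCLM_apply {k : ℕ} (y : Pt n) (v : Fin (n + 1) → Pt k) :
    paramCLM k y v = param v y := by
  simp [paramCLM, param_eq_sum]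

/-- A convex combination of the vertices moves no further than the vertex that moves most; the bound
is uniform in y. -/
theorem norm_paramCLM_le {k : ℕ} {y : Pt n} (hy : y ∈ corner n) : ‖paramCLM k y‖ ≤ 1 := by
  refine ContinuousLinearMap.opNorm_le_bound _ zero_le_one fun v => ?_
  rw [paramCLM_apply, param_eq_sum]
  calc ‖∑ j, baryCoord y j • v j‖ ≤ ∑ j, baryCoord y j * ‖v‖ := by
        refine norm_sum_le_of_le _ fun j _ => ?_
        rw [norm_smul, Real.norm_of_nonneg (baryCoord_nonneg hy j)]
        exact mul_le_mul_of_nonneg_left (norm_le_pi_norm v j) (baryCoord_nonneg hy j)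
    _ = 1 * ‖v‖ := by rw [← Finset.sum_mul, sum_baryCoord]

theorem continuous_paramCLM (k : ℕ) : Continuous fun y : Pt n => paramCLM k y := by
  unfold paramCLM
  exact continuous_finsetSum _ fun j _ => (continuous_baryCoord j).smul continuous_const

theorem dist_param_le {k : ℕ} {v w : Fin (n + 1) → Pt k} {y : Pt n} (hy : y ∈ corner n) :
    dist (param v y) (param w y) ≤ dist v w := by
  rw [← paramCLM_apply, ← paramCLM_apply, dist_eq_norm, dist_eq_norm, ← map_sub]
  exact ((paramCLM k y).le_opNorm _).trans (mul_le_of_le_one_left (norm_nonneg _)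
    (norm_paramCLM_le hy))

/-- One compact subset of U holds all elements close to a given one. A continuous derivative is
bounded on it, which supplies the dominating constant for differentiation under the integral. -/
theorem exists_compact_simplex_subset {k : ℕ} {v₀ : Fin (n + 1) → Pt k} {U : Set (Pt k)}
    (hU : IsOpen U) (hv : simplex v₀ ⊆ U) :
    ∃ δ > 0, ∃ L : Set (Pt k), IsCompact L ∧ L ⊆ U ∧
      ∀ v ∈ Metric.ball v₀ δ, ∀ y ∈ corner n, param v y ∈ L := by
  obtain ⟨δ, hδ, hsub⟩ := (isCompact_simplex v₀).exists_cthickening_subset_open hU hv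
  refine ⟨δ, hδ, _, (isCompact_simplex v₀).cthickening, hsub, fun v hvb y hy => ?_⟩
  exact Metric.mem_cthickening_of_dist_le _ _ _ _ (param_mem_simplex v₀ hy)
    ((dist_param_le hy).trans (Metric.mem_ball.1 hvb).le)

theorem eventually_simplex_subset {k : ℕ} {v₀ : Fin (n + 1) → Pt k} {U : Set (Pt k)}
    (hU : IsOpen U) (hv : simplex v₀ ⊆ U) : ∀ᶠ v in 𝓝 v₀, simplex v ⊆ U := by
  obtain ⟨δ, hδ, L, -, hLU, hL⟩ := exists_compact_simplex_subset hU hv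
  filter_upwards [Metric.ball_mem_nhds v₀ hδ] with v hvb
  rw [simplex_eq_image]
  rintro _ ⟨y, hy, rfl⟩
  exact hLU (hL v hvb y hy)

theorem differentiableAt_integral_param {k : ℕ} {v₀ : Fin (n + 1) → Pt k} {U : Set (Pt k)}
    (hU : IsOpen U) (hv : simplex v₀ ⊆ U) {f : Pt k → ℝ} (hf : ContDiffOn ℝ 1 f U) :
    DifferentiableAt ℝ (fun v : Fin (n + 1) → Pt k => ∫ y in corner n, f (param v y)) v₀ := by
  obtain ⟨δ, hδ, L, hLc, hLU, hL⟩ := exists_compact_simplex_subset hU hv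
  have hf' : ContinuousOn (fderiv ℝ f) U := hf.continuousOn_fderiv_of_isOpen hU le_rfl
  obtain ⟨c, hc⟩ := hLc.exists_bound_of_continuousOn (hf'.mono hLU)
  have hcm := (isClosed_corner n).measurableSet
  have hball := Metric.ball_mem_nhds v₀ hδ
  have hmaps : Set.MapsTo (param v₀) (corner n) U := fun y hy => hv (param_mem_simplex v₀ hy)
  refine (hasFDerivAt_integral_of_dominated_of_fderiv_le (bound := fun _ => c)
    (F := fun v y => f (param v y)) (x₀ := v₀) (𝕜 := ℝ)
    (F' := fun v y => (fderiv ℝ f (param v y)).comp (paramCLM k y)) hball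
    ?_ (integrableOn_param hf.continuousOn hv) ?_ ?_ ?_ ?_).differentiableAt
  · filter_upwards [eventually_simplex_subset hU hv] with v hvU
    exact (integrableOn_param hf.continuousOn hvU).aestronglyMeasurable
  · refine ContinuousOn.aestronglyMeasurable ?_ hcm
    exact (hf'.comp (continuous_param v₀).continuousOn hmaps).clm_comp
      (continuous_paramCLM k).continuousOn
  · filter_upwards [ae_restrict_mem hcm] with y hy v hvb
    calc _ ≤ ‖fderiv ℝ f (param v y)‖ * ‖paramCLM k y‖ := ContinuousLinearMap.opNorm_comp_le _ _
      _ ≤ ‖fderiv ℝ f (param v y)‖ * 1 :=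
        mul_le_mul_of_nonneg_left (norm_paramCLM_le hy) (norm_nonneg _)
      _ ≤ c := by rw [mul_one]; exact hc _ (hL v hvb y hy)
  · refine integrableOn_const ?_
    rw [volume_corner]; exact ENNReal.ofReal_ne_top
  · filter_upwards [ae_restrict_mem hcm] with y hy v hvb
    have hmem := hLU (hL v hvb y hy)
    have h1 : HasFDerivAt f (fderiv ℝ f (param v y)) (paramCLM k y v) := by
      rw [paramCLM_apply]
      exact ((hf.differentiableOn one_ne_zero).differentiableAt (hU.mem_nhds hmem)).hasFDerivAt
    simpa only [Function.comp_def, paramCLM_apply] using h1.comp v (paramCLM k y).hasFDerivAt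

section Entrywise
variable {X : Type*} [NormedAddCommGroup X] [NormedSpace ℝ X] {x₀ : X} {l m p : ℕ}

theorem differentiableAt_matrix_mul {A : X → Matrix (Fin l) (Fin m) ℝ}
    {B : X → Matrix (Fin m) (Fin p) ℝ} (hA : ∀ i j, DifferentiableAt ℝ (fun x => A x i j) x₀)
    (hB : ∀ i j, DifferentiableAt ℝ (fun x => B x i j) x₀) (i : Fin l) (j : Fin p) :
    DifferentiableAt ℝ (fun x => (A x * B x) i j) x₀ := by
  simp only [Matrix.mul_apply]
  exact DifferentiableAt.fun_sum fun r _ => (hA i r).mul (hB r j)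

theorem differentiableAt_det {A : X → Matrix (Fin m) (Fin m) ℝ}
    (hA : ∀ i j, DifferentiableAt ℝ (fun x => A x i j) x₀) :
    DifferentiableAt ℝ (fun x => (A x).det) x₀ := by
  simp only [Matrix.det_apply]
  refine DifferentiableAt.fun_sum fun σ _ => ?_
  simp only [Units.smul_def, zsmul_eq_mul]
  exact (HasFDerivAt.finsetProd fun i _ =>
    (hA (σ i) i).hasFDerivAt).differentiableAt.const_mul _

theorem differentiableAt_matrix_inv {A : X → Matrix (Fin m) (Fin m) ℝ}
    (hA : ∀ i j, DifferentiableAt ℝ (fun x => A x i j) x₀) (h0 : (A x₀).det ≠ 0) (i j : Fin m) :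
    DifferentiableAt ℝ (fun x => (A x)⁻¹ i j) x₀ := by
  simp only [Matrix.inv_def, Ring.inverse_eq_inv', Matrix.smul_apply, smul_eq_mul,
    Matrix.adjugate_apply]
  refine ((differentiableAt_det hA).inv h0).mul (differentiableAt_det fun r s => ?_)
  simp only [Matrix.updateRow_apply]
  split_ifs
  · exact differentiableAt_const _
  · exact hA r s

/-- Compactness of the unit sphere makes positivity of the form persist for nearby matrices in all
directions at once; homogeneity does the rest. -/
theorem eventually_posDef {Y : Type*} [TopologicalSpace Y] {y₀ : Y}
    {A : Y → Matrix (Fin m) (Fin m) ℝ} (hA : ∀ i j, ContinuousAt (fun y => A y i j) y₀)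
    (h0 : (A y₀).PosDef) (hs : ∀ᶠ y in 𝓝 y₀, (A y).IsSymm) : ∀ᶠ y in 𝓝 y₀, (A y).PosDef := by
  have key : ∀ᶠ y in 𝓝 y₀, ∀ x ∈ Metric.sphere (0 : Fin m → ℝ) 1, 0 < x ⬝ᵥ A y *ᵥ x := by
    refine (isCompact_sphere _ _).eventually_forall_of_forall_eventually fun x hx => ?_
    have hcont : ContinuousAt (fun z : Y × (Fin m → ℝ) => z.2 ⬝ᵥ A z.1 *ᵥ z.2) (y₀, x) := by
      simp only [dotProduct, Matrix.mulVec]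
      refine tendsto_finsetSum _ fun i _ => ?_
      refine ((continuous_apply i).comp continuous_snd).continuousAt.mul ?_
      refine tendsto_finsetSum _ fun j _ => ?_
      exact ((hA i j).comp_of_eq continuousAt_fst rfl).mul
        ((continuous_apply j).comp continuous_snd).continuousAt
    refine hcont.eventually_const_lt ((posDef_iff_real.1 h0).2 x ?_)
    rintro rfl
    simp at hx
  filter_upwards [key, hs] with y hy hsy
  refine posDef_iff_real.2 ⟨hsy, fun x hx => ?_⟩
  have hx' : 0 < ‖x‖ := norm_pos_iff.2 hx
  have h1 := hy (‖x‖⁻¹ • x) (by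
    rw [mem_sphere_zero_iff_norm, norm_smul, norm_inv, norm_norm, inv_mul_cancel₀ hx'.ne'])
  rw [Matrix.mulVec_smul, smul_dotProduct, dotProduct_smul, smul_eq_mul, smul_eq_mul] at h1
  exact pos_of_mul_pos_right (pos_of_mul_pos_right h1 (by positivity)) (by positivity)

end Entrywise

theorem differentiableAt_edgeMatrix {k : ℕ} (v₀ : Fin (n + 1) → Pt k) (i : Fin k) (j : Fin n) :
    DifferentiableAt ℝ (fun v : Fin (n + 1) → Pt k => edgeMatrix v i j) v₀ := by
  simp only [edgeMatrix, Matrix.of_apply]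
  fun_prop

theorem continuous_det_gram (n k : ℕ) :
    Continuous fun v : Fin (n + 1) → Pt k => ((edgeMatrix v)ᵀ * edgeMatrix v).det :=
  continuous_iff_continuousAt.2 fun v => (differentiableAt_det (differentiableAt_matrix_mul
    (fun i j => differentiableAt_edgeMatrix v j i)
    (differentiableAt_edgeMatrix v))).continuousAt

theorem barycentre_mem_simplex (v : Fin (n + 1) → Pt (n + 1)) : barycentre v ∈ simplex v := by
  rw [barycentre, Finset.smul_sum]
  refine (convex_convexHull ℝ _).sum_mem (fun _ _ => by positivity) ?_
    fun j _ => subset_convexHull ℝ _ ⟨j, rfl⟩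
  simp
  field_simp

variable {M : Pt (n + 1) → Matrix (Fin (n + 1)) (Fin (n + 1)) ℝ} {U : Set (Pt (n + 1))}
  {v₀ : Fin (n + 1) → Pt (n + 1)}

theorem differentiableAt_avgMetric (hU : IsOpen U)
    (hM : ∀ i j, ContDiffOn ℝ 1 (fun y => M y i j) U)
    (hv : 0 < ((edgeMatrix v₀)ᵀ * edgeMatrix v₀).det) (hvU : simplex v₀ ⊆ U)
    (i j : Fin (n + 1)) : DifferentiableAt ℝ (fun v => avgMetric M v i j) v₀ := by
  have h := (differentiableAt_integral_param hU hvU (hM i j)).const_mul (n.factorial : ℝ)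
  refine h.congr_of_eventuallyEq ?_
  -- The integral formula holds only for nondegenerate elements, an open condition on the vertices.
  filter_upwards [(continuous_det_gram n (n + 1)).continuousAt.eventually_const_lt hv] with v hv'
  exact avgMetric_apply hv' i j

theorem differentiableAt_pullback (ξ : Fin (n + 1) → Pt n) (hU : IsOpen U)
    (hM : ∀ i j, ContDiffOn ℝ 1 (fun y => M y i j) U)
    (hv : 0 < ((edgeMatrix v₀)ᵀ * edgeMatrix v₀).det) (hvU : simplex v₀ ⊆ U)
    (i j : Fin n) : DifferentiableAt ℝ (fun v => pullback ξ M v i j) v₀ := by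
  have hJ : ∀ i j, DifferentiableAt ℝ (fun v => jacobian ξ v i j) v₀ :=
    differentiableAt_matrix_mul (differentiableAt_edgeMatrix v₀) fun _ _ => differentiableAt_const _
  exact differentiableAt_matrix_mul (differentiableAt_matrix_mul (fun i j => hJ j i)
    (differentiableAt_avgMetric hU hM hv hvU)) hJ i j

theorem differentiableAt_element_energy {ξ : Fin (n + 1) → Pt n} (hU : IsOpen U)
    (hM : ∀ i j, ContDiffOn ℝ 1 (fun y => M y i j) U) (hMs : ∀ y ∈ U, (M y).IsSymm)
    {G : Matrix (Fin n) (Fin n) ℝ → ℝ → Pt (n + 1) → ℝ}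
    (hG : ContDiffOn ℝ 1
      (fun p : (Fin n → Fin n → ℝ) × ℝ × Pt (n + 1) => G (Matrix.of p.1) p.2.1 p.2.2)
      {p | (Matrix.of p.1).PosDef ∧ 0 < p.2.1 ∧ p.2.2 ∈ U})
    (hv : 0 < ((edgeMatrix v₀)ᵀ * edgeMatrix v₀).det) (hvU : simplex v₀ ⊆ U)
    (hA : (pullback ξ M v₀).PosDef) :
    DifferentiableAt ℝ (fun v => area n (simplex ξ) * Real.sqrt (pullback ξ M v).det *
      G (pullback ξ M v)⁻¹ (pullback ξ M v).det⁻¹ (barycentre v)) v₀ := by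
  have hpb := differentiableAt_pullback ξ hU hM hv hvU
  have hdet := differentiableAt_det hpb
  have hbary : Differentiable ℝ (barycentre : (Fin (n + 1) → Pt (n + 1)) → Pt (n + 1)) := by
    unfold barycentre; fun_prop
  set g : (Fin (n + 1) → Pt (n + 1)) → (Fin n → Fin n → ℝ) × ℝ × Pt (n + 1) :=
    fun v => (fun i j => (pullback ξ M v)⁻¹ i j, (pullback ξ M v).det⁻¹, barycentre v) with hg
  have hgd : DifferentiableAt ℝ g v₀ := by
    refine DifferentiableAt.prodMk ?_ ((hdet.inv hA.det_pos.ne').prodMk (hbary v₀))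
    exact differentiableAt_pi.2 fun i => differentiableAt_pi.2 fun j =>
      differentiableAt_matrix_inv hpb hA.det_pos.ne' i j
  have hsymm : ∀ᶠ v in 𝓝 v₀, (pullback ξ M v).IsSymm := by
    filter_upwards [(continuous_det_gram n (n + 1)).continuousAt.eventually_const_lt hv,
      eventually_simplex_subset hU hvU] with v hv' hvU'
    rw [Matrix.IsSymm, pullback, Matrix.transpose_mul, Matrix.transpose_mul,
      Matrix.transpose_transpose, avgMetric_isSymm hMs hv' hvU', Matrix.mul_assoc]
  have hpos := eventually_posDef (fun i j => (hpb i j).continuousAt) hA hsymm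
  -- Nearby elements keep the arguments of G in its domain, so differentiability within the domain
  -- yields differentiability at v₀.
  have hmem : ∀ᶠ v in 𝓝 v₀, g v ∈ {p : (Fin n → Fin n → ℝ) × ℝ × Pt (n + 1) |
      (Matrix.of p.1).PosDef ∧ 0 < p.2.1 ∧ p.2.2 ∈ U} := by
    filter_upwards [hpos, eventually_simplex_subset hU hvU] with v hpv hvU'
    exact ⟨hpv.inv, inv_pos.2 hpv.det_pos, hvU' (barycentre_mem_simplex v)⟩
  have hcomp := ((hG.differentiableOn one_ne_zero _ hmem.self_of_nhds).comp v₀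
    hgd.differentiableWithinAt (fun _ hx => hx)).differentiableAt hmem
  exact ((hdet.sqrt hA.det_pos.ne').const_mul _).mul hcomp

end Differentiability

/-! ### Positive definiteness of the metric Gram matrix of an element. -/

section Element

variable {n : ℕ} {M : Pt (n + 1) → Matrix (Fin (n + 1)) (Fin (n + 1)) ℝ}
  {U : Set (Pt (n + 1))} {v : Fin (n + 1) → Pt (n + 1)}

theorem posDef_of_sub_smul_one {m : ℕ} {A : Matrix (Fin m) (Fin m) ℝ} {c : ℝ} (hc : 0 < c)
    (h : (A - c • (1 : Matrix _ _ ℝ)).PosSemidef) : A.PosDef := by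
  have h1 : (c • (1 : Matrix (Fin m) (Fin m) ℝ)).PosDef := Matrix.PosDef.one.smul hc
  simpa using h1.add_posSemidef h

theorem gram_posDef (hM : ∀ i j, ContinuousOn (fun y => M y i j) U) (hvU : simplex v ⊆ U)
    {mlo : ℝ} (hmlo : 0 < mlo)
    (hMlo : ∀ y ∈ simplex v, (M y - mlo • (1 : Matrix _ _ ℝ)).PosSemidef)
    (hv : 0 < ((edgeMatrix v)ᵀ * edgeMatrix v).det) :
    ((edgeMatrix v)ᵀ * avgMetric M v * edgeMatrix v).PosDef :=
  PosDef.transpose_mul_mul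
    (posDef_of_sub_smul_one hmlo (avgMetric_sub_posSemidef hM hvU hMlo hv)) hv.ne'

end Element

/-! ### Bounds and differentiability for whole meshes. -/

section Mesh

variable {n : ℕ} {ν κ : Type*}

theorem elem_simplex_subset {S : Set (Pt (n + 1))} (conn : κ → Fin (n + 1) → ν)
    {x : ν → Pt (n + 1)} (hx : ∀ i, x i ∈ S) (K : κ) :
    simplex (elem conn x K) ⊆ convexHull ℝ S := by
  refine convexHull_mono ?_
  rintro _ ⟨j, rfl⟩
  exact hx _

theorem elemArea_eq (conn : κ → Fin (n + 1) → ν) (x : ν → Pt (n + 1)) (K : κ) :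
    elemArea conn x K =
      Real.sqrt ((edgeMatrix (elem conn x K))ᵀ * edgeMatrix (elem conn x K)).det / n.factorial :=
  area_simplex _

theorem continuous_elemArea (conn : κ → Fin (n + 1) → ν) (K : κ) :
    Continuous fun x : ν → Pt (n + 1) => elemArea conn x K := by
  simp only [elemArea_eq]
  refine ((continuous_det_gram n (n + 1)).comp ?_).sqrt.div_const _
  unfold elem
  fun_prop

theorem le_of_between_smul_one {m : ℕ} {A : Matrix (Fin (m + 1)) (Fin (m + 1)) ℝ} {a b : ℝ}
    (ha : (A - a • (1 : Matrix _ _ ℝ)).PosSemidef) (hb : (b • (1 : Matrix _ _ ℝ) - A).PosSemidef) :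
    a ≤ b := by
  have h1 := ha.diag_nonneg (i := 0)
  have h2 := hb.diag_nonneg (i := 0)
  simp at h1 h2
  linarith

variable [Fintype κ]

/-- The bounds for the elements of a nonsingular mesh on the surface in terms of an upper bound for
the energy. -/
theorem element_bounds (hn : n ≠ 0) {S U : Set (Pt (n + 1))} (hSU : convexHull ℝ S ⊆ U)
    {M : Pt (n + 1) → Matrix (Fin (n + 1)) (Fin (n + 1)) ℝ}
    (hM : ∀ i j, ContinuousOn (fun y => M y i j) U)
    {mlo mhi : ℝ} (hmlo : 0 < mlo)
    (hMlo : ∀ y ∈ convexHull ℝ S, (M y - mlo • (1 : Matrix _ _ ℝ)).PosSemidef)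
    (hMhi : ∀ y ∈ convexHull ℝ S, (mhi • (1 : Matrix _ _ ℝ) - M y).PosSemidef)
    (conn : κ → Fin (n + 1) → ν)
    {ξ : Fin (n + 1) → Pt n} (hξ : IsEquilateral ξ)
    (hξN : area n (simplex ξ) = 1 / (Fintype.card κ : ℕ))
    {G : Matrix (Fin n) (Fin n) ℝ → ℝ → Pt (n + 1) → ℝ}
    {α β q : ℝ} (hα : 0 < α) (hβ : 0 ≤ β) (hq : (n : ℝ) / 2 < q)
    (hcoer : ∀ J : Matrix (Fin n) (Fin n) ℝ, J.PosDef → ∀ y ∈ convexHull ℝ S,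
      α * J.trace ^ q - β ≤ G J J.det y)
    {x : ν → Pt (n + 1)} (hxS : ∀ i, x i ∈ S) (hx : ∀ K, 0 < elemArea conn x K) {B : ℝ}
    (hB : meshEnergy ξ M G conn x + β * (mhi ^ ((n : ℝ) / 2) * ∑ K, elemArea conn x K) ≤ B)
    (K : κ) :
    0 < B ∧ altitudeBound (n + 1) (Fintype.card κ) α q B ≤
        minAltitude (avgMetric M (elem conn x K)) (elem conn x K) ∧
      altitudeBound (n + 1) (Fintype.card κ) α q B ^ n / n.factorial ≤
        mhi ^ ((n : ℝ) / 2) * elemArea conn x K := by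
  have hN : 0 < Fintype.card κ := Fintype.card_pos_iff.2 ⟨K⟩
  have hN' : (0 : ℝ) < Fintype.card κ := by exact_mod_cast hN
  have hfac : (0 : ℝ) < n.factorial := by positivity
  have : Nonempty (Fin n) := ⟨⟨0, Nat.pos_of_ne_zero hn⟩⟩
  have hξ0 : (edgeMatrix ξ).det ≠ 0 := by
    intro h
    rw [area_reference, h, abs_zero, zero_div] at hξN
    exact absurd hξN (by positivity)
  have hmhi : 0 < mhi := by
    have hy := elem_simplex_subset conn hxS K (barycentre_mem_simplex _)
    exact hmlo.trans_le (le_of_between_smul_one (hMlo _ hy) (hMhi _ hy))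
  have hdet : ∀ L, 0 < ((edgeMatrix (elem conn x L))ᵀ * edgeMatrix (elem conn x L)).det :=
    fun L => (area_simplex_pos_iff _).1 (hx L)
  have hsub := elem_simplex_subset conn hxS
  have hH : ∀ L, ((edgeMatrix (elem conn x L))ᵀ * avgMetric M (elem conn x L) *
      edgeMatrix (elem conn x L)).PosDef := fun L =>
    gram_posDef hM ((hsub L).trans hSU) hmlo (fun y hy => hMlo y (hsub L hy)) (hdet L)
  have hA : ∀ L, (pullback ξ M (elem conn x L)).PosDef := fun L => pullback_posDef M hξ0 (hH L)
  have harea : ∀ L, Real.sqrt ((edgeMatrix (elem conn x L))ᵀ * avgMetric M (elem conn x L) *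
      edgeMatrix (elem conn x L)).det / n.factorial ≤ mhi ^ ((n : ℝ) / 2) * elemArea conn x L := by
    intro L
    have := sqrt_det_le_rpow_mul hmhi (hH L) (sub_avgMetric_posSemidef hM ((hsub L).trans hSU)
      (fun y hy => hMhi y (hsub L hy)) (hdet L))
    rw [elemArea_eq, ← mul_div_assoc]
    gcongr
  set T : κ → ℝ := fun L => area n (simplex ξ) * Real.sqrt (pullback ξ M (elem conn x L)).det *
    (pullback ξ M (elem conn x L))⁻¹.trace ^ q with hT
  have hξpos : 0 < area n (simplex ξ) := by rw [hξN]; positivity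
  have hTpos : ∀ L, 0 < T L := fun L => by
    have h1 := Real.sqrt_pos.2 (hA L).det_pos
    have h2 := (hA L).inv.trace_pos
    positivity
  -- Coercivity applies because r_K = det J_K. The terms with -β cost β times the metric area, which
  -- the Euclidean area times mhi^(n/2) absorbs.
  have hsum : ∑ L, α * T L ≤ B := by
    refine le_trans ?_ hB
    rw [Finset.mul_sum, Finset.mul_sum, meshEnergy, ← Finset.sum_add_distrib]
    refine Finset.sum_le_sum fun L _ => ?_
    have h1 := hcoer _ (hA L).inv _ (hsub L (barycentre_mem_simplex _))
    rw [Matrix.det_nonsing_inv, Ring.inverse_eq_inv'] at h1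
    have h2 := area_mul_sqrt_det_pullback M hξ0 (v := elem conn x L)
    have h3 : 0 ≤ area n (simplex ξ) * Real.sqrt (pullback ξ M (elem conn x L)).det := by
      positivity
    have h4 := mul_le_mul_of_nonneg_left h1 h3
    have h5 := mul_le_mul_of_nonneg_left (harea L) hβ
    rw [← h2] at h5
    simp only [hT]
    linarith
  -- All summands are positive, so the bound for the sum holds for each element.
  have hE : α * T K ≤ B := (Finset.single_le_sum (f := fun L => α * T L)
    (fun L _ => (mul_pos hα (hTpos L)).le) (Finset.mem_univ K)).trans hsum
  have hBpos : 0 < B := (mul_pos hα (hTpos K)).trans_le hE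
  have hQ := altitudeBound_sq_mul_coordForm_le hn hN hξ hξN M (hH K) hα hq hE
  refine ⟨hBpos, le_minAltitude (hH K) hn hQ, ?_⟩
  refine le_trans ?_ (harea K)
  have ha := altitudeBound_pos (d := n + 1) (by lia) hN (q := q) hα hBpos
  exact div_le_div_of_nonneg_right (pow_le_sqrt_det hn (hH K) ha hQ) hfac.le

variable [Fintype ν]

/-- The derivative is in the ambient space: neighbouring meshes may leave S, but their elements
remain in the open set U. -/
theorem differentiableAt_meshEnergy {S U : Set (Pt (n + 1))} (hU : IsOpen U)
    (hSU : convexHull ℝ S ⊆ U) {M : Pt (n + 1) → Matrix (Fin (n + 1)) (Fin (n + 1)) ℝ}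
    (hM : ∀ i j, ContDiffOn ℝ 1 (fun y => M y i j) U) (hMs : ∀ y ∈ U, (M y).IsSymm)
    {mlo : ℝ} (hmlo : 0 < mlo)
    (hMlo : ∀ y ∈ convexHull ℝ S, (M y - mlo • (1 : Matrix _ _ ℝ)).PosSemidef)
    (conn : κ → Fin (n + 1) → ν) {ξ : Fin (n + 1) → Pt n} (hξ0 : (edgeMatrix ξ).det ≠ 0)
    {G : Matrix (Fin n) (Fin n) ℝ → ℝ → Pt (n + 1) → ℝ}
    (hG : ContDiffOn ℝ 1
      (fun p : (Fin n → Fin n → ℝ) × ℝ × Pt (n + 1) => G (Matrix.of p.1) p.2.1 p.2.2)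
      {p | (Matrix.of p.1).PosDef ∧ 0 < p.2.1 ∧ p.2.2 ∈ U})
    {x : ν → Pt (n + 1)} (hxS : ∀ i, x i ∈ S) (hx : ∀ K, 0 < elemArea conn x K) :
    DifferentiableAt ℝ (meshEnergy ξ M G conn) x := by
  unfold meshEnergy
  refine DifferentiableAt.fun_sum fun K _ => ?_
  have hdet := (area_simplex_pos_iff _).1 (hx K)
  have hsub := elem_simplex_subset conn hxS K
  have hA := pullback_posDef M hξ0 (gram_posDef (fun i j => (hM i j).continuousOn)
    (hsub.trans hSU) hmlo (fun y hy => hMlo y (hsub hy)) hdet)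
  have hel : DifferentiableAt ℝ (fun x : ν → Pt (n + 1) => elem conn x K) x := by
    unfold elem
    fun_prop
  exact (differentiableAt_element_energy hU hM hMs hG hdet (hsub.trans hSU) hA).comp x hel

end Mesh

/-! ### The moving mesh equation: invariance of the surface, energy decay, first degeneration. -/

section Flow

variable {n : ℕ} {ν κ : Type*} [DecidableEq ν]

/-- The projection removes the normal component, so Φ is stationary along the flow. -/
theorem inner_gradient_mmpdeVelocity (Φ : Pt (n + 1) → ℝ) (P : ν → (ν → Pt (n + 1)) → ℝ) (τ : ℝ)
    (I : (ν → Pt (n + 1)) → ℝ) (x : ν → Pt (n + 1)) (i : ν) :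
    inner ℝ (∇ Φ (x i)) (mmpdeVelocity Φ P τ I x i) = 0 := by
  rw [mmpdeVelocity, unitNormal, inner_smul_right, inner_sub_right, inner_smul_right,
    inner_smul_right, inner_smul_right, real_inner_self_eq_norm_sq, real_inner_comm]
  rcases eq_or_ne ‖∇ Φ (x i)‖ 0 with h | h
  · rw [norm_eq_zero.1 h]; simp
  · field_simp
    ring

/-- The product is -P_i / τ times ‖g‖² - (g ⬝ n_i)², which is nonnegative by Cauchy-Schwarz as soon
as ‖n_i‖ ≤ 1. -/
theorem inner_vertexGradient_mmpdeVelocity_nonpos (Φ : Pt (n + 1) → ℝ)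
    {P : ν → (ν → Pt (n + 1)) → ℝ} {τ : ℝ} (hτ : 0 < τ) (I : (ν → Pt (n + 1)) → ℝ)
    {x : ν → Pt (n + 1)} {i : ν} (hP : 0 < P i x) :
    inner ℝ (vertexGradient I x i) (mmpdeVelocity Φ P τ I x i) ≤ 0 := by
  rw [mmpdeVelocity, inner_smul_right, inner_sub_right, inner_smul_right,
    real_inner_self_eq_norm_sq]
  set g := vertexGradient I x i
  have hu : ‖unitNormal Φ (x i)‖ ≤ 1 := by
    rw [unitNormal, norm_smul, norm_inv, norm_norm]
    exact inv_mul_le_one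
  have hcs : |inner ℝ g (unitNormal Φ (x i))| ≤ ‖g‖ :=
    (abs_real_inner_le_norm _ _).trans (mul_le_of_le_one_right (norm_nonneg _) hu)
  have hsq : inner ℝ g (unitNormal Φ (x i)) * inner ℝ g (unitNormal Φ (x i)) ≤ ‖g‖ ^ 2 := by
    rw [← abs_mul_abs_self, sq]
    exact mul_self_le_mul_self (abs_nonneg _) hcs
  have : 0 < P i x / τ := by positivity
  nlinarith

variable {Ω : Set (Pt (n + 1))} {Φ : Pt (n + 1) → ℝ} {conn : κ → Fin (n + 1) → ν}
  {P : ν → (ν → Pt (n + 1)) → ℝ} {τ : ℝ} {I : (ν → Pt (n + 1)) → ℝ} {T : Set ℝ}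
  {X : ℝ → ν → Pt (n + 1)}

theorem IsTrajectory.Icc_subset (hX : IsTrajectory Ω Φ conn P τ I T X) {t : ℝ} (ht : t ∈ T) :
    Set.Icc 0 t ⊆ T :=
  hX.interval.out hX.zero_mem ht

/-- As long as no element degenerates, the vertices stay on the surface. -/
theorem IsTrajectory.mem_surface (hX : IsTrajectory Ω Φ conn P τ I T X) (hΩ : IsOpen Ω)
    (hΦ : ContDiffOn ℝ 1 Φ Ω) {t : ℝ} (ht : t ∈ T)
    (hgood : ∀ s ∈ Set.Ico 0 t, ∀ K, 0 < elemArea conn (X s) K) (i : ν) : Φ (X t i) = 0 := by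
  have hsub := hX.Icc_subset ht
  have hcont : ContinuousOn (fun s => Φ (X s i)) (Set.Icc 0 t) :=
    hΦ.continuousOn.comp (((continuous_apply i).comp_continuousOn hX.continuousOn).mono hsub)
      fun s hs => hX.mem s (hsub hs) i
  -- Right derivatives on [0, t) suffice, so the equation is not used at t itself, where an element
  -- may be degenerate.
  have hconst := constant_of_has_deriv_right_zero hcont fun s hs => by
    have hsT := hsub ⟨hs.1, hs.2.le⟩
    have h1 : HasFDerivAt Φ (fderiv ℝ Φ (X s i)) (X s i) :=
      ((hΦ.differentiableOn one_ne_zero).differentiableAt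
        (hΩ.mem_nhds (hX.mem s hsT i))).hasFDerivAt
    have h2 := h1.comp_hasDerivWithinAt s (hX.equation s hsT (hgood s hs) i)
    have h3 : fderiv ℝ Φ (X s i) (mmpdeVelocity Φ P τ I (X s) i) = 0 := by
      rw [← inner_gradient_mmpdeVelocity Φ P τ I (X s) i, gradient,
        InnerProductSpace.toDual_symm_apply]
    rw [h3] at h2
    refine h2.mono_of_mem_nhdsWithin ?_
    exact Filter.mem_of_superset (Icc_mem_nhdsGE hs.2) ((Set.Icc_subset_Icc_left hs.1).trans hsub)
  exact (hconst t ⟨hX.nonneg ht, le_rfl⟩).trans (hX.initial i).2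

/-- If the element areas are bounded below by a positive constant as long as no element
degenerates, then no element ever degenerates. -/
theorem IsTrajectory.elemArea_pos [Finite κ] (hX : IsTrajectory Ω Φ conn P τ I T X)
    (hX0 : ∀ K, 0 < elemArea conn (X 0) K) {c : ℝ} (hc : 0 < c)
    (hbound : ∀ t ∈ T, (∀ s ∈ Set.Icc 0 t, ∀ K, 0 < elemArea conn (X s) K) →
      ∀ K, c ≤ elemArea conn (X t) K) :
    ∀ t ∈ T, ∀ K, 0 < elemArea conn (X t) K := by
  by_contra! hbad
  obtain ⟨t₁, ht₁, K₁, hK₁⟩ := hbad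
  have hcont : ∀ K, ContinuousOn (fun s => elemArea conn (X s) K) T := fun K =>
    (continuous_elemArea conn K).comp_continuousOn hX.continuousOn
  -- Z is the compact set of degenerate times up to t₁; its least element r is the first time of
  -- degeneration.
  set Z : Set ℝ := ⋃ K, {s | s ∈ Set.Icc 0 t₁ ∧ elemArea conn (X s) K ≤ 0} with hZ
  have hsub := hX.Icc_subset ht₁
  have hZc : IsCompact Z := isCompact_Icc.of_isClosed_subset
    (isClosed_iUnion_of_finite fun K =>
      isClosed_Icc.isClosed_le ((hcont K).mono hsub) continuousOn_const)
    (Set.iUnion_subset fun K s hs => hs.1)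
  obtain ⟨r, hrZ, hrmin⟩ := hZc.exists_isLeast
    ⟨t₁, Set.mem_iUnion.2 ⟨K₁, ⟨hX.nonneg ht₁, le_rfl⟩, hK₁⟩⟩
  obtain ⟨K, hr, hK⟩ := Set.mem_iUnion.1 hrZ
  have hr0 : 0 < r := by
    refine lt_of_le_of_ne hr.1 fun h => ?_
    rw [← h] at hK
    exact absurd (hX0 K) (not_lt.2 hK)
  have hgood : ∀ s ∈ Set.Ico 0 r, ∀ K, 0 < elemArea conn (X s) K := fun s hs L => by
    by_contra h
    have : s ∈ Z := Set.mem_iUnion.2 ⟨L, ⟨hs.1, hs.2.le.trans hr.2⟩, not_lt.1 h⟩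
    exact absurd (hrmin this) (not_le.2 hs.2)
  have hcl : closure (Set.Ico 0 r) = Set.Icc 0 r := closure_Ico hr0.ne
  have hrT : Set.Icc 0 r ⊆ T := hX.Icc_subset (hsub hr)
  -- The bound c on [0, r) extends to r by continuity, against the vanishing area there.
  have := le_on_closure (s := Set.Ico 0 r) (f := fun _ => c)
    (g := fun s => elemArea conn (X s) K) (x := r)
    (fun s hs => hbound s (hrT ⟨hs.1, hs.2.le⟩)
      (fun s' hs' => hgood s' ⟨hs'.1, hs'.2.trans_lt hs.2⟩) K)
    continuousOn_const (by rw [hcl]; exact (hcont K).mono hrT) (by rw [hcl]; exact ⟨hr0.le, le_rfl⟩)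
  linarith

variable [Fintype ν]

/-- V is a sum of displacements of single vertices, and each partial gradient represents the
derivative along one of them. -/
theorem fderiv_eq_sum_inner_vertexGradient {x : ν → Pt (n + 1)}
    (hI : DifferentiableAt ℝ I x) (V : ν → Pt (n + 1)) :
    fderiv ℝ I x V = ∑ i, inner ℝ (vertexGradient I x i) (V i) := by
  conv_lhs => rw [← Finset.univ_sum_single V]
  rw [map_sum]
  refine Finset.sum_congr rfl fun i _ => ?_
  have h1 : HasFDerivAt I (fderiv ℝ I x) (Function.update x i (x i)) := by
    rw [Function.update_eq_self]; exact hI.hasFDerivAt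
  have h2 := h1.comp (x i) (hasFDerivAt_update (𝕜 := ℝ) x (x i))
  have h3 : vertexGradient I x i = _ := h2.hasGradientAt.gradient
  rw [h3, InnerProductSpace.toDual_symm_apply, ContinuousLinearMap.comp_apply]
  congr 1
  ext j
  by_cases hj : j = i
  · subst hj; simp
  · simp [hj]

/-- The energy decreases as long as no element degenerates. -/
theorem IsTrajectory.energy_le (hX : IsTrajectory Ω Φ conn P τ I T X) (hτ : 0 < τ) {t : ℝ}
    (ht : t ∈ T) (hgood : ∀ s ∈ Set.Icc 0 t, ∀ K, 0 < elemArea conn (X s) K)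
    (hI : ∀ s ∈ Set.Icc 0 t, DifferentiableAt ℝ I (X s))
    (hP : ∀ s ∈ Set.Icc 0 t, ∀ i, 0 < P i (X s)) : I (X t) ≤ I (X 0) := by
  have hsub := hX.Icc_subset ht
  have hder : ∀ s ∈ Set.Icc 0 t, HasDerivWithinAt (fun s => I (X s))
      (fderiv ℝ I (X s) (mmpdeVelocity Φ P τ I (X s))) T s := fun s hs =>
    (hI s hs).hasFDerivAt.comp_hasDerivWithinAt s
      (hasDerivWithinAt_pi.2 fun i => hX.equation s (hsub hs) (hgood s hs) i)
  refine image_le_of_deriv_right_le_deriv_boundary (a := 0) (b := t)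
    (f := fun s => I (X s)) (f' := fun s => fderiv ℝ I (X s) (mmpdeVelocity Φ P τ I (X s)))
    (B := fun _ => I (X 0)) (B' := fun _ => 0)
    (fun s hs => ((hder s hs).mono hsub).continuousWithinAt) (fun s hs => ?_) le_rfl
    continuousOn_const (fun s _ => hasDerivWithinAt_const _ _ _) (fun s hs => ?_)
    ⟨hX.nonneg ht, le_rfl⟩
  · refine (hder s ⟨hs.1, hs.2.le⟩).mono_of_mem_nhdsWithin ?_
    exact Filter.mem_of_superset (Icc_mem_nhdsGE hs.2) ((Set.Icc_subset_Icc_left hs.1).trans hsub)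
  · have hs' : s ∈ Set.Icc 0 t := ⟨hs.1, hs.2.le⟩
    rw [fderiv_eq_sum_inner_vertexGradient (hI s hs')]
    exact Finset.sum_nonpos fun i _ =>
      inner_vertexGradient_mmpdeVelocity_nonpos Φ hτ I (hP s hs' i)

end Flow

/-- The stated area bound is the n-th power of the altitude bound over n!, weakened by a further
factor n^(n/2) ≥ 1. -/
theorem C2_mul_eq {n N : ℕ} (hn : n ≠ 0) (hN : 0 < N) (α : ℝ) {q B : ℝ} (hB : 0 < B)
    (hq : (n : ℝ) / 2 < q) :
    C2 (n + 1) α q * B ^ (-((((n + 1 : ℕ) : ℝ) - 1) / (2 * q - (n + 1 : ℕ) + 1))) *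
      (N : ℝ) ^ (-(2 * q / (2 * q - (n + 1 : ℕ) + 1))) =
      altitudeBound (n + 1) N α q B ^ n / n.factorial / (n : ℝ) ^ ((n : ℝ) / 2) := by
  have hn' : (0 : ℝ) < n := by exact_mod_cast Nat.pos_of_ne_zero hn
  have hN' : (0 : ℝ) < N := by exact_mod_cast hN
  have hp : 0 < 2 * q - n := by linarith
  have hd1 : ((n + 1 : ℕ) : ℝ) - 1 = n := by push_cast; ring
  have e1 : 2 * q - ((n + 1 : ℕ) : ℝ) + 1 = 2 * q - n := by push_cast; ring
  have e2 : -(1 / (2 * q - n)) * (n : ℝ) = -(n / (2 * q - n)) := by ring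
  have e3 : -(2 * q / (n * (2 * q - n))) * (n : ℝ) = -(2 * q / (2 * q - n)) := by field_simp
  unfold C2 altitudeBound
  rw [hd1, e1, Nat.add_sub_cancel, mul_pow, mul_pow, ← Real.rpow_natCast (B ^ _),
    ← Real.rpow_mul hB.le, ← Real.rpow_natCast ((N : ℝ) ^ _), ← Real.rpow_mul hN'.le, e2, e3]
  generalize B ^ (-((n : ℝ) / (2 * q - n))) = b
  generalize (N : ℝ) ^ (-(2 * q / (2 * q - n))) = c
  generalize C1 (n + 1) α q ^ n = a
  rw [div_div, mul_comm (n.factorial : ℝ)]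
  ring

end SurfaceMesh

/-! ### Assembly of the theorem. -/

theorem theorem4p1
    -- the dimension `d = n + 1 ≥ 2`
    (n d : ℕ) (hd : d = n + 1) (hd2 : 2 ≤ d)
    -- the bounded regular surface `S`
    (Ω S : Set (Pt (n + 1))) (Φ : Pt (n + 1) → ℝ)
    (hΩ : IsOpen Ω) (hΦ : ContDiffOn ℝ 1 Φ Ω)
    (hS : S = {y | y ∈ Ω ∧ Φ y = 0}) (hSb : Bornology.IsBounded S)
    (hΦ' : ∀ y ∈ S, ∇ Φ y ≠ 0)
    -- the metric tensor, defined near the convex hull of `S`, which contains all elements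
    (U : Set (Pt (n + 1))) (hU : IsOpen U) (hSU : convexHull ℝ S ⊆ U)
    (M : Pt (n + 1) → Matrix (Fin (n + 1)) (Fin (n + 1)) ℝ)
    (hM : ∀ i j, ContDiffOn ℝ 1 (fun y => M y i j) U) (hMs : ∀ y ∈ U, (M y).IsSymm)
    (mlo mhi : ℝ) (hmlo : 0 < mlo)
    (hMlo : ∀ y ∈ convexHull ℝ S, (M y - mlo • (1 : Matrix _ _ ℝ)).PosSemidef)
    (hMhi : ∀ y ∈ convexHull ℝ S, (mhi • (1 : Matrix _ _ ℝ) - M y).PosSemidef)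
    -- the mesh and the reference element
    {ν κ : Type*} [Fintype ν] [DecidableEq ν] [Fintype κ] (conn : κ → Fin (n + 1) → ν)
    (N : ℕ) (hN : N = Fintype.card κ)
    (ξ : Fin (n + 1) → Pt n) (hξ : IsEquilateral ξ) (hξN : area n (simplex ξ) = 1 / N)
    -- the coercive meshing function
    (G : Matrix (Fin n) (Fin n) ℝ → ℝ → Pt (n + 1) → ℝ)
    (hG : ContDiffOn ℝ 1
      (fun p : (Fin n → Fin n → ℝ) × ℝ × Pt (n + 1) => G (Matrix.of p.1) p.2.1 p.2.2)
      {p | (Matrix.of p.1).PosDef ∧ 0 < p.2.1 ∧ p.2.2 ∈ U})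
    (α β q : ℝ) (hα : 0 < α) (hβ : 0 ≤ β) (hq : ((d : ℝ) - 1) / 2 < q)
    (hcoer : ∀ J : Matrix (Fin n) (Fin n) ℝ, J.PosDef → ∀ y ∈ convexHull ℝ S,
      α * J.trace ^ q - β ≤ G J J.det y)
    -- a trajectory of the surface moving mesh equation, nonsingular at the initial time
    (P : ν → (ν → Pt (n + 1)) → ℝ) (hP : ∀ i x, (∀ j, x j ∈ S) → 0 < P i x)
    (τ : ℝ) (hτ : 0 < τ) (T : Set ℝ) (X : ℝ → ν → Pt (n + 1))
    (hX : IsTrajectory Ω Φ conn P τ (meshEnergy ξ M G conn) T X)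
    (hX0 : ∀ K, 0 < elemArea conn (X 0) K) :
    -- no element ever degenerates
    (∀ t ∈ T, ∀ K, 0 < elemArea conn (X t) K) ∧
    -- the lower bounds hold, with the exponent `(d - 1) / 2` of `mhi`, and with `d / 2` if `1 ≤ mhi`
    ∀ e : ℝ, (e = ((d : ℝ) - 1) / 2 ∨ (e = (d : ℝ) / 2 ∧ 1 ≤ mhi)) →
      ∀ t ∈ T, (β = 0 ∨ ∑ K, elemArea conn (X t) K ≤ area n S) → ∀ K,
        C1 d α q *
            (meshEnergy ξ M G conn (X 0) + β * mhi ^ e * area n S) ^ (-(1 / (2 * q - d + 1))) *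
            (N : ℝ) ^ (-(2 * q / (((d : ℝ) - 1) * (2 * q - d + 1))))
          ≤ minAltitude (avgMetric M (elem conn (X t) K)) (elem conn (X t) K) ∧
        C2 d α q *
            (meshEnergy ξ M G conn (X 0) + β * mhi ^ e * area n S) ^
              (-(((d : ℝ) - 1) / (2 * q - d + 1))) *
            (N : ℝ) ^ (-(2 * q / (2 * q - d + 1))) * mhi ^ (-e)
          ≤ elemArea conn (X t) K := by
  subst hd
  have hn : n ≠ 0 := by lia
  have hn' : (0 : ℝ) < n := by exact_mod_cast Nat.pos_of_ne_zero hn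
  have hn1 : (1 : ℝ) ≤ n := by exact_mod_cast Nat.one_le_iff_ne_zero.2 hn
  have hd1 : ((n + 1 : ℕ) : ℝ) - 1 = n := by push_cast; ring
  have hMc : ∀ i j, ContinuousOn (fun y => M y i j) U := fun i j => (hM i j).continuousOn
  rw [hd1] at hq
  subst hN
  have hmem : ∀ t ∈ T, (∀ s ∈ Set.Icc 0 t, ∀ K, 0 < elemArea conn (X s) K) →
      ∀ s ∈ Set.Icc 0 t, ∀ i, X s i ∈ S := by
    intro t ht hgood s hs i
    have hsT := hX.Icc_subset ht hs
    rw [hS]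
    exact ⟨hX.mem s hsT i, hX.mem_surface hΩ hΦ hsT
      (fun r hr => hgood r ⟨hr.1, hr.2.le.trans hs.2⟩) i⟩
  -- An element is demanded because for an empty mesh N = 0 and the reference area 1 / N is 0, which
  -- makes the reference edge matrix singular.
  have henergy : ∀ t ∈ T, (∀ s ∈ Set.Icc 0 t, ∀ K, 0 < elemArea conn (X s) K) → κ →
      meshEnergy ξ M G conn (X t) ≤ meshEnergy ξ M G conn (X 0) := by
    intro t ht hgood K
    have hN' : (0 : ℝ) < Fintype.card κ := by exact_mod_cast Fintype.card_pos_iff.2 ⟨K⟩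
    have hξ0 : (edgeMatrix ξ).det ≠ 0 := by
      intro h
      rw [area_reference, h, abs_zero, zero_div] at hξN
      exact absurd hξN (by positivity)
    exact hX.energy_le hτ ht hgood
      (fun s hs => differentiableAt_meshEnergy hU hSU hM hMs hmlo hMlo conn hξ0 hG
        (hmem t ht hgood s hs) (hgood s hs))
      (fun s hs i => hP i _ (hmem t ht hgood s hs))
  have hmhi : κ → 0 < mhi := fun K => by
    have hy := subset_convexHull ℝ S (hmem 0 hX.zero_mem (fun s hs => by
      obtain rfl : s = 0 := le_antisymm hs.2 hs.1
      exact hX0) 0 ⟨le_rfl, le_rfl⟩ (conn K 0))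
    exact hmlo.trans_le (le_of_between_smul_one (hMlo _ hy) (hMhi _ hy))
  have hpos : ∀ t ∈ T, ∀ K, 0 < elemArea conn (X t) K := by
    intro t ht K₀
    -- The comparison of the total area with that of S is not assumed at all times. Continuity of
    -- the areas on the compact set of meshes with vertices in the closure of S gives a bound R to
    -- use in its place.
    obtain ⟨R, hR⟩ : ∃ R, ∀ x : ν → Pt (n + 1), (∀ i, x i ∈ S) → ∑ K, elemArea conn x K ≤ R := by
      have hcomp : IsCompact (Set.univ.pi fun _ : ν => closure S) :=
        isCompact_univ_pi fun _ => hSb.isCompact_closure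
      obtain ⟨R, hR⟩ := hcomp.bddAbove_image
        (continuous_finsetSum Finset.univ fun K _ => continuous_elemArea conn K).continuousOn
      exact ⟨R, fun x hx => hR ⟨x, fun i _ => subset_closure (hx i), rfl⟩⟩
    have hm := hmhi K₀
    have hmp : 0 < mhi ^ ((n : ℝ) / 2) := by positivity
    set B := meshEnergy ξ M G conn (X 0) + β * (mhi ^ ((n : ℝ) / 2) * R) with hBdef
    have hbounds : ∀ t ∈ T, (∀ s ∈ Set.Icc 0 t, ∀ K, 0 < elemArea conn (X s) K) → ∀ K,
        0 < B ∧ altitudeBound (n + 1) (Fintype.card κ) α q B ^ n / n.factorial ≤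
          mhi ^ ((n : ℝ) / 2) * elemArea conn (X t) K := by
      intro t ht hgood K
      have htt : t ∈ Set.Icc 0 t := ⟨hX.nonneg ht, le_rfl⟩
      have hxS := hmem t ht hgood t htt
      have hB : meshEnergy ξ M G conn (X t) +
          β * (mhi ^ ((n : ℝ) / 2) * ∑ K, elemArea conn (X t) K) ≤ B := by
        have h1 := henergy t ht hgood K
        have h2 := hR _ hxS
        rw [hBdef]
        gcongr
      have h := element_bounds hn hSU hMc hmlo hMlo hMhi conn hξ hξN hα hβ hq hcoer hxS
        (hgood t htt) hB K
      exact ⟨h.1, h.2.2⟩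
    have hB : 0 < B := (hbounds 0 hX.zero_mem (fun s hs => by
      obtain rfl : s = 0 := le_antisymm hs.2 hs.1
      exact hX0) K₀).1
    have ha := altitudeBound_pos (d := n + 1) (N := Fintype.card κ) hd2
      (Fintype.card_pos_iff.2 ⟨K₀⟩) (q := q) hα hB
    refine hX.elemArea_pos hX0 (c := altitudeBound (n + 1) (Fintype.card κ) α q B ^ n /
      n.factorial / mhi ^ ((n : ℝ) / 2)) (by positivity) (fun t ht hgood K => ?_) t ht K₀
    rw [div_le_iff₀ hmp, mul_comm (elemArea _ _ _)]
    exact (hbounds t ht hgood K).2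
  refine ⟨hpos, fun e he t ht hβS K => ?_⟩
  have hm := hmhi K
  have hN : 0 < Fintype.card κ := Fintype.card_pos_iff.2 ⟨K⟩
  have hN' : (0 : ℝ) < Fintype.card κ := by exact_mod_cast hN
  -- The argument yields the exponent n / 2; a larger one only weakens the bounds when mhi ≥ 1.
  have hme : mhi ^ ((n : ℝ) / 2) ≤ mhi ^ e := by
    rcases he with rfl | ⟨rfl, h1⟩
    · rw [hd1]
    · refine Real.rpow_le_rpow_of_exponent_le h1 ?_
      push_cast
      linarith
  have hme0 : 0 < mhi ^ e := by positivity
  have hgood : ∀ s ∈ Set.Icc 0 t, ∀ K, 0 < elemArea conn (X s) K := fun s hs =>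
    hpos s (hX.Icc_subset ht hs)
  have htt : t ∈ Set.Icc 0 t := ⟨hX.nonneg ht, le_rfl⟩
  set B := meshEnergy ξ M G conn (X 0) + β * mhi ^ e * area n S with hBdef
  have hB : meshEnergy ξ M G conn (X t) +
      β * (mhi ^ ((n : ℝ) / 2) * ∑ K, elemArea conn (X t) K) ≤ B := by
    refine add_le_add (henergy t ht hgood K) ?_
    rcases hβS with h0 | h0
    · simp [h0]
    · rw [mul_assoc]
      have : 0 ≤ ∑ K, elemArea conn (X t) K := Finset.sum_nonneg fun L _ => (hpos t ht L).le
      exact mul_le_mul_of_nonneg_left (mul_le_mul hme h0 this hme0.le) hβ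
  obtain ⟨hB0, halt, harea⟩ := element_bounds hn hSU hMc hmlo hMlo hMhi conn hξ hξN hα hβ hq hcoer
    (hmem t ht hgood t htt) (hgood t htt) hB K
  refine ⟨halt, ?_⟩
  rw [C2_mul_eq hn hN α hB0 hq, Real.rpow_neg hm.le, ← div_eq_mul_inv, div_div,
    div_le_iff₀ (by positivity)]
  refine harea.trans ?_
  rw [mul_comm (elemArea _ _ _)]
  refine mul_le_mul_of_nonneg_right ?_ (hpos t ht K).le
  calc mhi ^ ((n : ℝ) / 2) ≤ mhi ^ e := hme
    _ = 1 * mhi ^ e := (one_mul _).symm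
    _ ≤ _ := mul_le_mul_of_nonneg_right (Real.one_le_rpow hn1 (by positivity)) hme0.le
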